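/- For an integer $\lambda\ge 1$ put $N=\lfloor\sqrt{\lambda}\rfloor+1$ and $$\mathcal F_{4,\lambda}=\{\xi=(\xi_1,\xi_2,\xi_3,\xi_4)\in\mathbb Z^4:\ |\xi_1|^2+|\xi_2|^2+|\xi_3|^2+|\xi_4|^2=\lambda\},$$ and for a finite set $\Lambda\subset\mathbb Z^4$ let $$\mathbb E(\Lambda)=\bigl|\{(\xi_1,\xi_2,\xi_3,\xi_4)\in\Lambda^4:\ \xi_1+\xi_2=\xi_3+\xi_4\}\bigr|$$ be its additive energy. Then for every $\epsilon>0$ there is a constant $C_\epsilon>0$, depending only on $\epsilon$, such that for every integer $\lambda\ge 1$ and every subset $\Lambda\subseteq\mathcal F_{4,\lambda}$ $$\mathbb E(\Lambda)\le C_\epsilon\, N^{\epsilon}\,|\Lambda|^{7/3}.$$ -/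

import Mathlib

/-- The integer points of `ℤⁿ` on the sphere of radius `√lam` centred at the origin. -/
def latticeSphere (n lam : ℕ) : Set (Fin n → ℤ) :=
  {ξ | ∑ i, |ξ i| ^ 2 = (lam : ℤ)}

/-- The scale `N = ⌊√lam⌋ + 1`. -/
def sphereScale (lam : ℕ) : ℕ := Nat.sqrt lam + 1

/-! If a + b = c with |a| = |b|, then a lies on the hyperplane H_c : 2 x·c = |c|². So the number
r(c) of representations of c is at most the number of points of Λ on H_c, and the energy is the sum
of r(c)². Dually, p ∈ Λ becomes the hyperplane 2 p·y = 1 and c ≠ 0 the point c/|c|², and the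
question is how many points of ℝ⁴ lie on at least k of n = |Λ| hyperplanes.

Arithmetic input: distinct H_c, H_c' share at most s = O(λ^ε) points of Λ, because they are disjoint
or meet in a plane, which cuts the sphere in a circle (`exists_card_sphere_inter_plane_le`). The
lattice points of the circle inject into the representations of one integer, polynomially bounded in
λ, by X² + D Y² with D squarefree; the divisor bound controls these.

Combinatorial input: about n/D sampled hyperplanes (up to a logarithm) yield O((n/D)⁴) simplices,
each crossed by O(D) of the n hyperplanes (`exists_cutting`). With D ≈ k²/s, double counting in each
simplex (`card_mul_le_of_card_inter_le`, `card_rich_mul_le`) bounds k² times the number of k-rich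
points by n⁴/k⁵ when k² ≤ n, up to powers of s and log n. This is at most n^{7/3} as soon as k ≥
n^{1/3}; larger k give at most n². The c with r(c) ≲ s n^{1/3} contribute at most s n^{1/3} Σ r(c) =
s n^{7/3}, and the others are summed dyadically. -/

/-! ### The divisor bound -/

/-- The number of divisors is the product of a + 1 over the prime powers p^a exactly dividing n.
Once p^ε ≥ 2, a + 1 ≤ 2^a ≤ p^{aε} costs nothing; each prime below P costs a factor at most K. -/
theorem exists_card_divisors_le_rpow (ε : ℝ) (hε : 0 < ε) :
    ∃ C : ℝ, 1 ≤ C ∧ ∀ n : ℕ, n ≠ 0 → (n.divisors.card : ℝ) ≤ C * (n : ℝ) ^ ε := by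
  set P : ℕ := ⌈(2 : ℝ) ^ (1 / ε)⌉₊ with hP
  -- With t = ε log 2, Bernoulli gives p^{aε} ≥ 1 + a t, and this K makes K (1 + a t) ≥ a + 1.
  set K : ℝ := 1 + 1 / (ε * Real.log 2) with hK
  have hlog : 0 < ε * Real.log 2 := mul_pos hε (Real.log_pos (by norm_num))
  have hK1 : 1 ≤ K := by rw [hK]; have := one_div_pos.2 hlog; linarith
  refine ⟨K ^ P, one_le_pow₀ hK1, fun n hn => ?_⟩
  have key : ∀ p ∈ n.primeFactors, ((n.factorization p : ℝ) + 1) ≤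
      (if p < P then K else 1) * ((p : ℝ) ^ (n.factorization p)) ^ ε := by
    intro p hp
    have hp2 : 2 ≤ p := (Nat.prime_of_mem_primeFactors hp).two_le
    have hp2' : (2 : ℝ) ≤ p := by exact_mod_cast hp2
    set a := n.factorization p
    have hpow : ((p : ℝ) ^ a) ^ ε = ((p : ℝ) ^ ε) ^ a := by
      rw [← Real.rpow_natCast, ← Real.rpow_mul (by positivity), mul_comm, Real.rpow_mul (by positivity),
        Real.rpow_natCast]
    rw [hpow]
    split_ifs with h
    · have h1 : (1 + ε * Real.log 2) ≤ (p : ℝ) ^ ε := by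
        calc 1 + ε * Real.log 2 ≤ Real.exp (ε * Real.log 2) := by
              have := Real.add_one_le_exp (ε * Real.log 2); linarith
          _ = (2 : ℝ) ^ ε := by rw [Real.rpow_def_of_pos (by norm_num), mul_comm]
          _ ≤ _ := Real.rpow_le_rpow (by norm_num) hp2' hε.le
      have h2 : 1 + (a : ℝ) * (ε * Real.log 2) ≤ ((p : ℝ) ^ ε) ^ a :=
        (one_add_mul_le_pow (by linarith) a).trans (pow_le_pow_left₀ (by positivity) h1 a)
      have h3 : (a : ℝ) + 1 ≤ K * (1 + (a : ℝ) * (ε * Real.log 2)) := by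
        have ha : (0 : ℝ) ≤ a := by positivity
        have : K * (1 + (a : ℝ) * (ε * Real.log 2)) =
            1 + (a : ℝ) * (ε * Real.log 2) + 1 / (ε * Real.log 2) + a := by
          rw [hK]; generalize ε * Real.log 2 = t at hlog; field_simp; ring
        rw [this]
        have := one_div_pos.2 hlog
        nlinarith [mul_nonneg ha hlog.le]
      exact h3.trans (mul_le_mul_of_nonneg_left h2 (by linarith))
    · have h1 : (2 : ℝ) ≤ (p : ℝ) ^ ε := by
        have : (2 : ℝ) ^ (1 / ε) ≤ p := (Nat.le_ceil _).trans (by exact_mod_cast not_lt.1 h)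
        calc (2 : ℝ) = ((2 : ℝ) ^ (1 / ε)) ^ ε := by
              rw [← Real.rpow_mul (by norm_num), one_div_mul_cancel hε.ne', Real.rpow_one]
          _ ≤ _ := Real.rpow_le_rpow (by positivity) this hε.le
      have h2 : (a : ℝ) + 1 ≤ 2 ^ a := by exact_mod_cast Nat.lt_two_pow_self
      rw [one_mul]
      exact h2.trans (pow_le_pow_left₀ (by norm_num) h1 a)
  have hprod : (n : ℝ) ^ ε = ∏ p ∈ n.primeFactors, ((p : ℝ) ^ (n.factorization p)) ^ ε := by
    rw [Real.finsetProd_rpow _ _ (fun i _ => by positivity)]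
    congr 1
    conv_lhs => rw [← Nat.prod_factorization_pow_eq_self hn]
    simp [Finsupp.prod]
  have hcst : ∏ p ∈ n.primeFactors, (if p < P then K else 1) ≤ K ^ P := by
    rw [Finset.prod_ite, Finset.prod_const, Finset.prod_const_one, mul_one]
    refine pow_le_pow_right₀ hK1 ?_
    calc _ ≤ (Finset.range P).card := Finset.card_le_card (by intro p; simp)
      _ = P := Finset.card_range P
  calc (n.divisors.card : ℝ) = ∏ p ∈ n.primeFactors, ((n.factorization p : ℝ) + 1) := by
        rw [Nat.card_divisors hn]; push_cast; rfl
    _ ≤ ∏ p ∈ n.primeFactors,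
          ((if p < P then K else 1) * ((p : ℝ) ^ (n.factorization p)) ^ ε) :=
        Finset.prod_le_prod (fun i _ => by positivity) key
    _ = (∏ p ∈ n.primeFactors, (if p < P then K else 1)) * (n : ℝ) ^ ε := by
        rw [Finset.prod_mul_distrib, hprod]
    _ ≤ _ := mul_le_mul_of_nonneg_right hcst (by positivity)

/-! ### Representations by `x² + D y²` -/

/-- If k² ∣ M and k ∣ x, then k² ∣ D y² with k coprime to y, so k² ∣ D and k is a unit. This applies
to e when e is odd and to e/2 when e is even. -/
theorem Int.dvd_two_of_sq_dvd_form {D M x y e : ℤ} (hD : Squarefree D) (hM : x ^ 2 + D * y ^ 2 = M)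
    (hy : IsCoprime y M) (he : e ^ 2 ∣ M) (hx : e ∣ 2 * x) : e ∣ 2 := by
  have key : ∀ k : ℤ, k ^ 2 ∣ M → k ∣ x → IsUnit k := by
    intro k hk hkx
    have h1 : k ^ 2 ∣ D * y ^ 2 := by
      have : D * y ^ 2 = M - x ^ 2 := by linarith
      rw [this]; exact dvd_sub hk (pow_dvd_pow_of_dvd hkx 2)
    have h2 : IsCoprime (k ^ 2) (y ^ 2) := (hy.of_isCoprime_of_dvd_right hk).symm.pow_right
    have h3 : k ^ 2 ∣ D := h2.dvd_of_dvd_mul_right h1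
    exact hD k (by rwa [sq] at h3)
  rcases Int.even_or_odd e with ⟨k, hk⟩ | ho
  · have hk2 : e = 2 * k := by linarith
    have hkx : k ∣ x := by
      rw [hk2] at hx; exact (mul_dvd_mul_iff_left (by norm_num : (2 : ℤ) ≠ 0)).1 hx
    have hkM : k ^ 2 ∣ M := (pow_dvd_pow_of_dvd (Dvd.intro_left 2 hk2.symm) 2).trans he
    have := key k hkM hkx
    rw [hk2]
    exact mul_dvd_of_dvd_div (by norm_num) (by simpa using this.dvd)
  · have : IsCoprime e 2 := by
      obtain ⟨k, rfl⟩ := ho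
      exact ⟨1, -k, by ring⟩
    exact (key e he (this.dvd_of_dvd_mul_left hx)).dvd

theorem IsCoprime.right_of_form {D M x y : ℤ} (hM : x ^ 2 + D * y ^ 2 = M) (hxy : IsCoprime x y) :
    IsCoprime y M := by
  have h : IsCoprime (x ^ 2) y := hxy.pow_left
  rw [← hM]
  have : x ^ 2 + D * y ^ 2 = x ^ 2 + y * (D * y) := by ring
  rw [this]
  exact (h.add_mul_left_left (D * y)).symm

/-- Fix one solution (x0, y0). Any other satisfies (x y0)² − (x0 y)² = M (y0² − y²), so M = d m with
d ∣ x y0 − x0 y, m ∣ x y0 + x0 y and gcd(d, m) ∣ 2. The divisor d thus determines the ratio x : y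
modulo M up to a factor 2, and at most ten solutions share the same d. -/
theorem card_primitive_reps_le {D M : ℤ} (hD : Squarefree D) (hD0 : 0 < D) (hM0 : 0 < M)
    (S : Finset (ℤ × ℤ)) (hS : ∀ p ∈ S, IsCoprime p.1 p.2 ∧ p.1 ^ 2 + D * p.2 ^ 2 = M) :
    S.card ≤ 10 * M.natAbs.divisors.card := by
  classical
  rcases S.eq_empty_or_nonempty with rfl | ⟨⟨x0, y0⟩, h0⟩
  · simp
  obtain ⟨hc0, hM1⟩ := hS _ h0
  simp only at hc0 hM1
  have hy0 := IsCoprime.right_of_form hM1 hc0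
  let F : ℤ × ℤ → ℕ := fun p => Int.gcd (p.1 * y0 - x0 * p.2) M
  have hF : S.image F ⊆ M.natAbs.divisors := by
    intro d hd
    obtain ⟨p, -, rfl⟩ := Finset.mem_image.1 hd
    rw [Nat.mem_divisors]
    exact ⟨Int.gcd_dvd_natAbs_right _ _, by simpa using hM0.ne'⟩
  -- divisibility data of a point
  have hdata : ∀ p ∈ S, ∃ m : ℤ, M = F p * m ∧ m ∣ p.1 * y0 + x0 * p.2 ∧
      ((F p : ℕ) : ℤ) ∣ p.1 * y0 - x0 * p.2 ∧ (Int.gcd (F p : ℤ) m : ℤ) ∣ 2 := by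
    rintro ⟨x, y⟩ hp
    obtain ⟨hc, hM2⟩ := hS _ hp
    simp only at hc hM2
    have hd1 : ((F (x, y) : ℕ) : ℤ) ∣ x * y0 - x0 * y := Int.gcd_dvd_left _ _
    obtain ⟨m, hm⟩ : ((F (x, y) : ℕ) : ℤ) ∣ M := Int.gcd_dvd_right _ _
    have hFpos : 0 < F (x, y) := Int.gcd_pos_of_ne_zero_right _ hM0.ne'
    obtain ⟨p', hp'⟩ := hd1
    have hcop : IsCoprime p' m := by
      have h1 : Int.gcd (((F (x, y) : ℕ) : ℤ) * p') (((F (x, y) : ℕ) : ℤ) * m) = F (x, y) := by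
        rw [← hp', ← hm]
      rw [Int.gcd_mul_left, Int.natAbs_natCast] at h1
      rw [Int.isCoprime_iff_gcd_eq_one]
      exact Nat.eq_of_mul_eq_mul_left hFpos (by rw [h1, mul_one])
    have hFz : ((F (x, y) : ℕ) : ℤ) ≠ 0 := by exact_mod_cast hFpos.ne'
    have hmq : m ∣ x * y0 + x0 * y := by
      have h1 : ((F (x, y) : ℕ) : ℤ) * m ∣ ((F (x, y) : ℕ) : ℤ) * (p' * (x * y0 + x0 * y)) := by
        rw [← mul_assoc, ← hp', ← hm]
        exact ⟨y0 ^ 2 - y ^ 2, by linear_combination y0 ^ 2 * hM2 - y ^ 2 * hM1⟩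
      exact hcop.symm.dvd_of_dvd_mul_left ((mul_dvd_mul_iff_left hFz).1 h1)
    refine ⟨m, hm, hmq, ⟨p', hp'⟩, ?_⟩
    set e : ℤ := (Int.gcd (F (x, y) : ℤ) m : ℤ)
    have he1 : e ∣ ((F (x, y) : ℕ) : ℤ) := Int.gcd_dvd_left _ _
    have he2 : e ∣ m := Int.gcd_dvd_right _ _
    have heM : e ^ 2 ∣ M := by rw [hm, sq]; exact mul_dvd_mul he1 he2
    have heq : e ∣ 2 * x * y0 := by
      have := dvd_add (he1.trans ⟨p', hp'⟩) (he2.trans hmq)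
      have h2 : x * y0 - x0 * y + (x * y0 + x0 * y) = 2 * x * y0 := by ring
      rwa [h2] at this
    have hey : IsCoprime e y0 :=
      (hy0.of_isCoprime_of_dvd_right ((Dvd.intro_left _ (sq e).symm).trans heM)).symm
    exact Int.dvd_two_of_sq_dvd_form hD hM2 (IsCoprime.right_of_form hM2 hc) heM
      (hey.dvd_of_dvd_mul_right heq)
  refine (Finset.card_le_mul_card_image (f := F) S 10 ?_).trans
    (Nat.mul_le_mul_left _ (Finset.card_le_card hF))
  intro d hd
  obtain ⟨⟨x1, y1⟩, hp1, hd1⟩ := Finset.mem_image.1 hd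
  obtain ⟨hc1, hM3⟩ := hS _ hp1
  simp only at hc1 hM3
  obtain ⟨m, hm, hmq, hdq, he⟩ := hdata _ hp1
  simp only at hmq hdq
  rw [hd1] at hm hdq he
  have hu : ∀ p ∈ S, F p = d → M ∣ 2 * (x1 * p.2 - p.1 * y1) := by
    rintro ⟨x, y⟩ hp hpd
    obtain ⟨m', hm', hmq', hdq', -⟩ := hdata _ hp
    simp only at hmq' hdq' ⊢
    rw [hpd] at hm' hdq'
    have hd0 : (d : ℤ) ≠ 0 := by rintro h; rw [h, zero_mul] at hm; exact hM0.ne' hm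
    obtain rfl : m = m' := mul_left_cancel₀ hd0 (hm.symm.trans hm')
    have hdy : IsCoprime (d : ℤ) y0 := (hy0.of_isCoprime_of_dvd_right ⟨m, hm⟩).symm
    have hmy : IsCoprime m y0 := (hy0.of_isCoprime_of_dvd_right (Dvd.intro_left _ hm.symm)).symm
    have h1 : (d : ℤ) ∣ x1 * y - x * y1 := by
      refine hdy.dvd_of_dvd_mul_left ?_
      have := dvd_sub (hdq.mul_left y) (hdq'.mul_left y1)
      convert this using 1; ring
    have h2 : m ∣ x1 * y - x * y1 := by
      refine hmy.dvd_of_dvd_mul_left ?_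
      have := dvd_sub (hmq.mul_left y) (hmq'.mul_left y1)
      convert this using 1; ring
    -- Both d and m divide the determinant; Bézout passes to their product M at the cost of gcd(d,
    -- m).
    have h3 : M ∣ (Int.gcd (d : ℤ) m : ℤ) * (x1 * y - x * y1) := by
      rw [Int.gcd_eq_gcd_ab, hm, add_mul]
      refine dvd_add ?_ ?_
      · rw [mul_assoc]; exact mul_dvd_mul_left _ (h2.mul_left _)
      · rw [mul_comm (d : ℤ) m, mul_assoc]; exact mul_dvd_mul_left _ (h1.mul_left _)
    exact h3.trans (mul_dvd_mul_right he _)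
  -- The identity (x1 x + D y1 y)² + D (x1 y − x y1)² = M² confines 2 (x1 y − x y1)/M to the
  -- integers in [−2, 2] and then fixes x1 x + D y1 y up to sign: five values times two signs.
  have hcard : ((Finset.Icc (-2 : ℤ) 2) ×ˢ (Finset.univ : Finset Bool)).card = 10 := by decide
  rw [← hcard]
  refine Finset.card_le_card_of_injOn
    (fun p => (2 * (x1 * p.2 - p.1 * y1) / M, decide (0 ≤ x1 * p.1 + D * y1 * p.2))) ?_ ?_
  · rintro ⟨x, y⟩ hp
    rw [Finset.mem_coe, Finset.mem_filter] at hp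
    obtain ⟨t, ht⟩ := hu _ hp.1 hp.2
    obtain ⟨-, hM2⟩ := hS _ hp.1
    simp only at ht hM2
    have h4 : (x1 * x + D * y1 * y) ^ 2 + D * (x1 * y - x * y1) ^ 2 = M ^ 2 := by
      rw [sq M]; nth_rewrite 1 [← hM2]; rw [← hM3]; ring
    have h5 : t ^ 2 ≤ 4 := by
      have h6 : D * (M ^ 2 * t ^ 2) ≤ 4 * M ^ 2 := by
        have : D * (M ^ 2 * t ^ 2) = 4 * (D * (x1 * y - x * y1) ^ 2) := by
          have : M ^ 2 * t ^ 2 = (2 * (x1 * y - x * y1)) ^ 2 := by rw [ht]; ring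
          rw [this]; ring
        nlinarith [sq_nonneg (x1 * x + D * y1 * y)]
      have h7 : M ^ 2 * t ^ 2 ≤ D * (M ^ 2 * t ^ 2) :=
        le_mul_of_one_le_left (by positivity) hD0
      have h8 : M ^ 2 * t ^ 2 ≤ M ^ 2 * 4 := by linarith
      exact le_of_mul_le_mul_left h8 (by positivity)
    have h9 : 2 * (x1 * y - x * y1) / M = t := by rw [ht, Int.mul_ediv_cancel_left _ hM0.ne']
    simp only [Finset.coe_product, Set.mem_prod, Finset.mem_coe, Finset.mem_Icc, h9, Finset.mem_univ,
      and_true]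
    constructor <;> nlinarith
  · rintro ⟨x, y⟩ hp ⟨x', y'⟩ hp' heq
    rw [Finset.mem_coe, Finset.mem_filter] at hp hp'
    have hM2 := (hS _ hp.1).2
    have hM2' := (hS _ hp'.1).2
    obtain ⟨t, ht⟩ := hu _ hp.1 hp.2
    obtain ⟨t', ht'⟩ := hu _ hp'.1 hp'.2
    simp only [Prod.mk.injEq, decide_eq_decide] at heq ht ht' hM2 hM2'
    obtain ⟨h1, h2⟩ := heq
    rw [ht, ht', Int.mul_ediv_cancel_left _ hM0.ne', Int.mul_ediv_cancel_left _ hM0.ne'] at h1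
    have hueq : x1 * y - x * y1 = x1 * y' - x' * y1 := by rw [h1, ← ht'] at ht; linarith
    have h4 : ∀ x y : ℤ, x ^ 2 + D * y ^ 2 = M →
        (x1 * x + D * y1 * y) ^ 2 + D * (x1 * y - x * y1) ^ 2 = M ^ 2 := by
      intro x y h; rw [sq M]; nth_rewrite 1 [← h]; rw [← hM3]; ring
    have hweq : x1 * x + D * y1 * y = x1 * x' + D * y1 * y' := by
      have h5 : (x1 * x + D * y1 * y) ^ 2 = (x1 * x' + D * y1 * y') ^ 2 := by
        have := h4 x y hM2
        have := h4 x' y' hM2'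
        rw [hueq] at *; linarith
      rcases sq_eq_sq_iff_eq_or_eq_neg.1 h5 with h | h
      · exact h
      · by_cases hw : 0 ≤ x1 * x + D * y1 * y
        · have := h2.1 hw; linarith
        · have h7 : ¬ 0 ≤ x1 * x' + D * y1 * y' := fun h => hw (h2.2 h)
          linarith
    have hx : M * x = M * x' := by
      rw [← hM3]; linear_combination x1 * hweq - D * y1 * hueq
    have hy : M * y = M * y' := by
      rw [← hM3]; linear_combination x1 * hueq + y1 * hweq
    exact Prod.ext (mul_left_cancel₀ hM0.ne' hx) (mul_left_cancel₀ hM0.ne' hy)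

/-- Dividing by g = gcd(x, y) gives a primitive representation of M/g². As g ∣ M, the choice of g
costs the second divisor factor. -/
theorem card_reps_le {D M : ℤ} (hD : Squarefree D) (hD0 : 0 < D) (hM0 : 0 < M)
    (S : Finset (ℤ × ℤ)) (hS : ∀ p ∈ S, p.1 ^ 2 + D * p.2 ^ 2 = M) :
    S.card ≤ 10 * M.natAbs.divisors.card ^ 2 := by
  classical
  let F : ℤ × ℤ → ℕ := fun p => Int.gcd p.1 p.2
  have hsq : ∀ p ∈ S, ((F p : ℕ) : ℤ) ^ 2 ∣ M := by
    rintro ⟨x, y⟩ hp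
    rw [← hS _ hp]
    exact dvd_add (pow_dvd_pow_of_dvd (Int.gcd_dvd_left _ _) 2)
      ((pow_dvd_pow_of_dvd (Int.gcd_dvd_right _ _) 2).mul_left _)
  have hF : S.image F ⊆ M.natAbs.divisors := by
    intro d hd
    obtain ⟨p, hp, rfl⟩ := Finset.mem_image.1 hd
    rw [Nat.mem_divisors]
    refine ⟨Int.natCast_dvd.1 ((Dvd.intro_left _ (sq _).symm).trans (hsq p hp)), by simpa using hM0.ne'⟩
  have hmain := Finset.card_le_mul_card_image (f := F) S (10 * M.natAbs.divisors.card) ?_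
  · calc S.card ≤ _ := hmain
      _ ≤ 10 * M.natAbs.divisors.card * M.natAbs.divisors.card :=
        Nat.mul_le_mul_left _ (Finset.card_le_card hF)
      _ = _ := by ring
  intro g hg
  obtain ⟨p0, hp0, hg0⟩ := Finset.mem_image.1 hg
  obtain ⟨M', hM'⟩ := hsq p0 hp0
  rw [hg0] at hM'
  have hgz : (g : ℤ) ≠ 0 := by rintro h; rw [h] at hM'; simp at hM'; exact hM0.ne' hM'
  have hM'0 : 0 < M' := by
    have : 0 < (g : ℤ) ^ 2 := by positivity
    by_contra h
    nlinarith
  have hdiv : M'.natAbs.divisors.card ≤ M.natAbs.divisors.card :=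
    Finset.card_le_card (Nat.divisors_subset_of_dvd (by simpa using hM0.ne')
      (Int.natAbs_dvd_natAbs.2 (Dvd.intro_left _ hM'.symm)))
  have hdvd : ∀ p ∈ S.filter (fun p => F p = g), (g : ℤ) ∣ p.1 ∧ (g : ℤ) ∣ p.2 := by
    intro p hp
    rw [← (Finset.mem_filter.1 hp).2]
    exact ⟨Int.gcd_dvd_left _ _, Int.gcd_dvd_right _ _⟩
  have hinj : Set.InjOn (fun p : ℤ × ℤ => (p.1 / (g : ℤ), p.2 / (g : ℤ)))
      (S.filter (fun p => F p = g)) := by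
    intro p hp q hq h
    obtain ⟨h1, h2⟩ := hdvd p hp
    obtain ⟨h3, h4⟩ := hdvd q hq
    simp only [Prod.mk.injEq] at h
    exact Prod.ext (by rw [← Int.ediv_mul_cancel h1, h.1, Int.ediv_mul_cancel h3])
      (by rw [← Int.ediv_mul_cancel h2, h.2, Int.ediv_mul_cancel h4])
  rw [← Finset.card_image_of_injOn hinj]
  refine (card_primitive_reps_le hD hD0 hM'0 _ ?_).trans (Nat.mul_le_mul_left _ hdiv)
  intro r hr
  obtain ⟨p, hp, rfl⟩ := Finset.mem_image.1 hr
  obtain ⟨⟨a, ha⟩, ⟨b, hb⟩⟩ := hdvd p hp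
  have hpg := (Finset.mem_filter.1 hp).2
  have hpS := hS p (Finset.mem_filter.1 hp).1
  simp only [F] at hpg
  rw [ha, hb] at hpg hpS
  simp only [ha, hb, Int.mul_ediv_cancel_left _ hgz]
  constructor
  · rw [Int.gcd_mul_left, Int.natAbs_natCast] at hpg
    rw [Int.isCoprime_iff_gcd_eq_one]
    have : 0 < g := Nat.pos_of_ne_zero (by exact_mod_cast hgz)
    exact Nat.eq_of_mul_eq_mul_left this (by rw [hpg, mul_one])
  · have : (g : ℤ) ^ 2 ≠ 0 := pow_ne_zero 2 hgz
    apply mul_left_cancel₀ this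
    rw [← hM', ← hpS]; ring

/-! ### Lattice points on circles -/

theorem exists_eq_zero_of_pairwise_orthogonal (F : Fin 5 → Fin 4 → ℤ)
    (hF : ∀ i j, i ≠ j → F i ⬝ᵥ F j = 0) : ∃ i, F i = 0 := by
  by_contra! hne
  let G : Fin 5 → EuclideanSpace ℝ (Fin 4) := fun i => WithLp.toLp 2 (fun k => (F i k : ℝ))
  have hG : ∀ i, G i ≠ 0 := by
    intro i h
    apply hne i
    funext k
    have := congrArg (fun v : EuclideanSpace ℝ (Fin 4) => v k) h
    simpa [G] using this
  have hind : LinearIndependent ℝ G := by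
    refine linearIndependent_of_ne_zero_of_inner_eq_zero hG fun i j hij => ?_
    have := hF j i hij.symm
    change inner ℝ (G i) (G j) = 0
    rw [EuclideanSpace.inner_eq_star_dotProduct]
    simp only [G, dotProduct] at this ⊢
    have h2 := congrArg (Int.cast : ℤ → ℝ) this
    push_cast at h2
    simpa using h2
  have := hind.fintype_card_le_finrank
  simp at this

theorem dotProduct_sq_le {n : ℕ} (x y : Fin n → ℤ) : (x ⬝ᵥ y) ^ 2 ≤ (x ⬝ᵥ x) * (y ⬝ᵥ y) := by
  have := Finset.sum_mul_sq_le_sq_mul_sq Finset.univ x y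
  simpa only [dotProduct, sq] using this

theorem dotProduct_self_nonneg_int {n : ℕ} (x : Fin n → ℤ) : 0 ≤ x ⬝ᵥ x :=
  Finset.sum_nonneg fun i _ => mul_self_nonneg (x i)

theorem dotProduct_self_pos_int {n : ℕ} {x : Fin n → ℤ} (hx : x ≠ 0) : 0 < x ⬝ᵥ x :=
  lt_of_le_of_ne (dotProduct_self_nonneg_int x) fun h => hx (dotProduct_self_eq_zero.1 h.symm)

/-- Lattice points on the intersection of a sphere in `ℝ⁴` with a plane, in terms of the
divisor function. -/
theorem card_sphere_inter_plane_le {lam : ℤ} {v w : Fin 4 → ℤ} (hv : v ≠ 0)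
    (hvw : (v ⬝ᵥ v) • w - (v ⬝ᵥ w) • v ≠ 0) {a b : ℤ} (S : Finset (Fin 4 → ℤ))
    (hS : ∀ x ∈ S, x ⬝ᵥ x = lam ∧ x ⬝ᵥ v = a ∧ x ⬝ᵥ w = b) (hcard : 3 ≤ S.card) :
    ∃ M : ℤ, 0 < M ∧ M ≤ 2 ^ 15 * lam ^ 8 ∧ S.card ≤ 10 * M.natAbs.divisors.card ^ 2 := by
  classical
  obtain ⟨x0, x1, x2, h0, h1, h2, h01, h02, h12⟩ := Finset.two_lt_card_iff.1 hcard
  obtain ⟨n0, a0, b0⟩ := hS _ h0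
  obtain ⟨n1, a1, b1⟩ := hS _ h1
  obtain ⟨n2, a2, b2⟩ := hS _ h2
  obtain ⟨e, he⟩ : ∃ e, e = x1 - x0 := ⟨_, rfl⟩
  obtain ⟨u, hu⟩ : ∃ u, u = x2 - x0 := ⟨_, rfl⟩
  have hx1 : x1 = x0 + e := by rw [he]; abel
  have hx2 : x2 = x0 + u := by rw [hu]; abel
  have he0 : e ≠ 0 := by rw [he]; exact sub_ne_zero.2 h01.symm
  have hu0 : u ≠ 0 := by rw [hu]; exact sub_ne_zero.2 h02.symm
  have hue : u ≠ e := by rw [hu, he]; intro h; exact h12 (sub_left_injective h).symm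
  have hlam : 0 ≤ lam := by rw [← n0]; exact dotProduct_self_nonneg_int _
  obtain ⟨A, hA⟩ : ∃ A, A = e ⬝ᵥ e := ⟨_, rfl⟩
  have hApos : 0 < A := by rw [hA]; exact dotProduct_self_pos_int he0
  -- Gram–Schmidt without denominators. The vector is nonzero because a line meets the sphere in at
  -- most two points.
  obtain ⟨f, hf⟩ : ∃ f, f = A • u - (u ⬝ᵥ e) • e := ⟨_, rfl⟩
  have hxe : 2 * (x0 ⬝ᵥ e) = -A := by
    rw [hx1] at n1
    simp only [dotProduct_add, add_dotProduct] at n1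
    rw [dotProduct_comm e x0] at n1
    rw [hA]; linarith
  have hxu : 2 * (x0 ⬝ᵥ u) = -(u ⬝ᵥ u) := by
    rw [hx2] at n2
    simp only [dotProduct_add, add_dotProduct] at n2
    rw [dotProduct_comm u x0] at n2
    linarith
  have hf0 : f ≠ 0 := by
    intro h
    rw [hf, sub_eq_zero] at h
    have c1 := congrArg (fun z => x0 ⬝ᵥ z) h
    have c2 := congrArg (fun z => u ⬝ᵥ z) h
    simp only [dotProduct_smul, smul_eq_mul] at c1 c2
    have d1 : A * (u ⬝ᵥ u) = A * (u ⬝ᵥ e) := by linear_combination (-2) * c1 + A * hxu - (u ⬝ᵥ e) * hxe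
    have d2 := mul_left_cancel₀ hApos.ne' d1
    have d3 : (u ⬝ᵥ e) ≠ 0 := by rw [← d2]; exact (dotProduct_self_pos_int hu0).ne'
    rw [d2] at c2
    have d4 : A = u ⬝ᵥ e := mul_right_cancel₀ d3 c2
    rw [← d4] at h
    exact hue (smul_right_injective _ hApos.ne' h)
  obtain ⟨B, hB⟩ : ∃ B, B = f ⬝ᵥ f := ⟨_, rfl⟩
  have hBpos : 0 < B := by rw [hB]; exact dotProduct_self_pos_int hf0
  have hef : e ⬝ᵥ f = 0 := by
    rw [hf, dotProduct_sub, dotProduct_smul, dotProduct_smul, ← hA, dotProduct_comm e u, smul_eq_mul,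
      smul_eq_mul]; ring
  have hev : e ⬝ᵥ v = 0 := by rw [he, sub_dotProduct, a0, a1, sub_self]
  have hew : e ⬝ᵥ w = 0 := by rw [he, sub_dotProduct, b0, b1, sub_self]
  have huv : u ⬝ᵥ v = 0 := by rw [hu, sub_dotProduct, a0, a2, sub_self]
  have huw : u ⬝ᵥ w = 0 := by rw [hu, sub_dotProduct, b0, b2, sub_self]
  have hfv : f ⬝ᵥ v = 0 := by
    rw [hf, sub_dotProduct, smul_dotProduct, smul_dotProduct, huv, hev]; simp
  have hfw : f ⬝ᵥ w = 0 := by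
    rw [hf, sub_dotProduct, smul_dotProduct, smul_dotProduct, huw, hew]; simp
  -- `e` and `f` span the direction of the plane
  have hspan : ∀ z : Fin 4 → ℤ, z ⬝ᵥ v = 0 → z ⬝ᵥ w = 0 →
      (A * B) • z - (B * (z ⬝ᵥ e)) • e - (A * (z ⬝ᵥ f)) • f = 0 := by
    intro z hzv hzw
    -- The remainder y of the orthogonal expansion is orthogonal to v, v', e and f, which are
    -- nonzero and pairwise orthogonal in dimension four; hence y = 0.
    obtain ⟨y, hy⟩ : ∃ y, y = (A * B) • z - (B * (z ⬝ᵥ e)) • e - (A * (z ⬝ᵥ f)) • f := ⟨_, rfl⟩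
    rw [← hy]
    obtain ⟨v', hv'⟩ : ∃ v', v' = (v ⬝ᵥ v) • w - (v ⬝ᵥ w) • v := ⟨_, rfl⟩
    rw [← hv'] at hvw
    have q1 : y ⬝ᵥ v = 0 := by
      rw [hy]; simp only [sub_dotProduct, smul_dotProduct, hzv, hev, hfv]; simp
    have q2 : y ⬝ᵥ w = 0 := by
      rw [hy]; simp only [sub_dotProduct, smul_dotProduct, hzw, hew, hfw]; simp
    have q3 : y ⬝ᵥ e = 0 := by
      rw [hy]
      simp only [sub_dotProduct, smul_dotProduct, ← hA, dotProduct_comm f e, hef, smul_eq_mul]; ring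
    have q4 : y ⬝ᵥ f = 0 := by
      rw [hy]; simp only [sub_dotProduct, smul_dotProduct, ← hB, hef, smul_eq_mul]; ring
    have r1 : v' ⬝ᵥ v = 0 := by
      rw [hv', sub_dotProduct, smul_dotProduct, smul_dotProduct, dotProduct_comm w v, smul_eq_mul,
        smul_eq_mul]; ring
    have r : ∀ t : Fin 4 → ℤ, t ⬝ᵥ v = 0 → t ⬝ᵥ w = 0 → t ⬝ᵥ v' = 0 := by
      intro t h1 h2
      rw [hv', dotProduct_sub, dotProduct_smul, dotProduct_smul, h1, h2]; simp
    have s1 := r y q1 q2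
    have s2 := r e hev hew
    have s3 := r f hfv hfw
    obtain ⟨i, hi⟩ := exists_eq_zero_of_pairwise_orthogonal ![v, v', e, f, y] (by
      intro i j hij
      fin_cases i <;> fin_cases j <;> first
        | exact absurd rfl hij
        | assumption
        | (rw [dotProduct_comm]; assumption))
    fin_cases i
    · exact absurd hi hv
    · exact absurd hi hvw
    · exact absurd hi he0
    · exact absurd hi hf0
    · exact hi
  -- This is A B times the squared length of the projection of x0 to the span of e and f. It is
  -- constant on S, since both |x|² and the component orthogonal to that span are.
  obtain ⟨m, hm⟩ : ∃ m, m = B * (x0 ⬝ᵥ e) ^ 2 + A * (x0 ⬝ᵥ f) ^ 2 := ⟨_, rfl⟩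
  have hform : ∀ x ∈ S, B * (x ⬝ᵥ e) ^ 2 + A * (x ⬝ᵥ f) ^ 2 = m := by
    intro x hx
    obtain ⟨nx, ax, bx⟩ := hS x hx
    obtain ⟨z, hz⟩ : ∃ z, z = x - x0 := ⟨_, rfl⟩
    have hxz : x = x0 + z := by rw [hz]; abel
    have hs := hspan z (by rw [hz, sub_dotProduct, ax, a0, sub_self])
      (by rw [hz, sub_dotProduct, bx, b0, sub_self])
    have t1 := congrArg (fun y => z ⬝ᵥ y) hs
    have t2 := congrArg (fun y => x0 ⬝ᵥ y) hs
    simp only [dotProduct_sub, dotProduct_smul, smul_eq_mul, dotProduct_zero] at t1 t2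
    have t3 : 2 * (x0 ⬝ᵥ z) = -(z ⬝ᵥ z) := by
      rw [hxz] at nx
      simp only [dotProduct_add, add_dotProduct] at nx
      rw [dotProduct_comm z x0] at nx
      linarith
    rw [hm, hxz, add_dotProduct, add_dotProduct]
    linear_combination (-1) * t1 - 2 * t2 + A * B * t3
  have hmpos : 0 < m := by
    have hm0 : 0 ≤ m := by rw [hm]; positivity
    refine lt_of_le_of_ne hm0 fun h => ?_
    have key : ∀ x ∈ S, x ⬝ᵥ e = 0 := by
      intro x hx
      have := hform x hx
      rw [← h] at this
      have p1 : 0 ≤ A * (x ⬝ᵥ f) ^ 2 := by positivity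
      have p2 : B * (x ⬝ᵥ e) ^ 2 = 0 := le_antisymm (by linarith) (by positivity)
      simpa [hBpos.ne'] using p2
    have := key _ h0
    rw [this] at hxe
    linarith
  have hAle : A ≤ 4 * lam := by
    have : (x1 + x0) ⬝ᵥ (x1 + x0) + (x1 - x0) ⬝ᵥ (x1 - x0) = 2 * (x1 ⬝ᵥ x1) + 2 * (x0 ⬝ᵥ x0) := by
      simp only [dotProduct_add, add_dotProduct, dotProduct_sub, sub_dotProduct]; ring
    rw [← he, ← hA, n1, n0] at this
    linarith [dotProduct_self_nonneg_int (x1 + x0)]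
  have hule : u ⬝ᵥ u ≤ 4 * lam := by
    have : (x2 + x0) ⬝ᵥ (x2 + x0) + (x2 - x0) ⬝ᵥ (x2 - x0) = 2 * (x2 ⬝ᵥ x2) + 2 * (x0 ⬝ᵥ x0) := by
      simp only [dotProduct_add, add_dotProduct, dotProduct_sub, sub_dotProduct]; ring
    rw [← hu, n2, n0] at this
    linarith [dotProduct_self_nonneg_int (x2 + x0)]
  have hBle : B ≤ 64 * lam ^ 3 := by
    have : B = A ^ 2 * (u ⬝ᵥ u) - A * (u ⬝ᵥ e) ^ 2 := by
      rw [hB, hf]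
      simp only [dotProduct_sub, sub_dotProduct, dotProduct_smul, smul_dotProduct, smul_eq_mul, ← hA,
        dotProduct_comm e u]; ring
    have h3 : 0 ≤ A * (u ⬝ᵥ e) ^ 2 := by positivity
    have h4 : A ^ 2 * (u ⬝ᵥ u) ≤ (4 * lam) ^ 2 * (4 * lam) :=
      mul_le_mul (pow_le_pow_left₀ hApos.le hAle 2) hule (dotProduct_self_nonneg_int u) (by positivity)
    rw [this]; nlinarith
  have hmle : m ≤ 2 * lam * A * B := by
    have c1 := dotProduct_sq_le x0 e
    have c2 := dotProduct_sq_le x0 f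
    rw [n0, ← hA] at c1
    rw [n0, ← hB] at c2
    have := mul_le_mul_of_nonneg_left c1 hBpos.le
    have := mul_le_mul_of_nonneg_left c2 hApos.le
    rw [hm]; linarith
  refine ⟨B * m, by positivity, ?_, ?_⟩
  · calc B * m ≤ B * (2 * lam * A * B) := mul_le_mul_of_nonneg_left hmle hBpos.le
      _ ≤ (64 * lam ^ 3) * (2 * lam * (4 * lam) * (64 * lam ^ 3)) := by gcongr
      _ = 2 ^ 15 * lam ^ 8 := by ring
  -- Multiplying the form by B and writing A B = g² D with D squarefree gives X² + D Y² = B m for X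
  -- = B (x·e), Y = g (x·f).
  · obtain ⟨D, g, hDpos, hgpos, hgD, hDsq⟩ :=
      Nat.sq_mul_squarefree_of_pos (n := (A * B).toNat) (by rw [Int.lt_toNat]; simp; positivity)
    have hgD' : (g : ℤ) ^ 2 * D = A * B := by
      have := congrArg (Nat.cast : ℕ → ℤ) hgD
      rw [Int.toNat_of_nonneg (by positivity)] at this
      exact_mod_cast this
    let φ : (Fin 4 → ℤ) → ℤ × ℤ := fun x => (B * (x ⬝ᵥ e), g * (x ⬝ᵥ f))
    have hφ : Set.InjOn φ S := by
      intro x hx y hy hxy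
      simp only [φ, Prod.mk.injEq] at hxy
      have k1 := mul_left_cancel₀ hBpos.ne' hxy.1
      have k2 := mul_left_cancel₀ (by exact_mod_cast hgpos.ne') hxy.2
      obtain ⟨-, ax, bx⟩ := hS x hx
      obtain ⟨-, ay, bY⟩ := hS y hy
      have hs := hspan (x - y) (by rw [sub_dotProduct, ax, ay, sub_self])
        (by rw [sub_dotProduct, bx, bY, sub_self])
      rw [sub_dotProduct, sub_dotProduct, k1, k2, sub_self, sub_self] at hs
      simp only [mul_zero, zero_smul, sub_zero] at hs
      exact sub_eq_zero.1 ((smul_eq_zero.1 hs).resolve_left (by positivity))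
    rw [← Finset.card_image_of_injOn hφ]
    refine card_reps_le (D := D) (Int.squarefree_natCast.2 hDsq) (by exact_mod_cast hDpos) (by positivity)
      _ fun p hp => ?_
    obtain ⟨x, hx, rfl⟩ := Finset.mem_image.1 hp
    simp only [φ]
    rw [← hform x hx]
    linear_combination (x ⬝ᵥ f) ^ 2 * hgD'

/-- A sphere of radius `√λ` in `ℝ⁴` and a plane share `O(λ ^ ε)` lattice points. -/
theorem exists_card_sphere_inter_plane_le (ε : ℝ) (hε : 0 < ε) :
    ∃ C : ℝ, 1 ≤ C ∧ ∀ lam : ℕ, 1 ≤ lam → ∀ v w : Fin 4 → ℤ, v ≠ 0 →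
      (v ⬝ᵥ v) • w - (v ⬝ᵥ w) • v ≠ 0 → ∀ (a b : ℤ) (S : Finset (Fin 4 → ℤ)),
      (∀ x ∈ S, x ⬝ᵥ x = lam ∧ x ⬝ᵥ v = a ∧ x ⬝ᵥ w = b) → (S.card : ℝ) ≤ C * (lam : ℝ) ^ ε := by
  -- The divisor count is squared and M = O(λ⁸), so the exponent is 2 · 8 · ε/16 = ε.
  obtain ⟨C, hC1, hC⟩ := exists_card_divisors_le_rpow (ε / 16) (by positivity)
  set K : ℝ := 10 * (C * ((2 : ℝ) ^ 15) ^ (ε / 16)) ^ 2 with hK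
  have hpow : (1 : ℝ) ≤ ((2 : ℝ) ^ 15) ^ (ε / 16) := Real.one_le_rpow (by norm_num) (by positivity)
  have hK10 : 10 ≤ K := by
    have : 1 ≤ (C * ((2 : ℝ) ^ 15) ^ (ε / 16)) ^ 2 := one_le_pow₀ (one_le_mul_of_one_le_of_one_le hC1 hpow)
    rw [hK]; linarith
  refine ⟨K, by linarith, fun lam hlam v w hv hvw a b S hS => ?_⟩
  have hlam1 : (1 : ℝ) ≤ lam := by exact_mod_cast hlam
  rcases lt_or_ge S.card 3 with h | h
  · have h1 : (1 : ℝ) ≤ (lam : ℝ) ^ ε := Real.one_le_rpow hlam1 hε.le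
    have h2 : (S.card : ℝ) ≤ 3 := by exact_mod_cast h.le
    nlinarith
  obtain ⟨M, hM0, hM, hcard⟩ := card_sphere_inter_plane_le hv hvw S hS h
  have hMn : (M.natAbs : ℝ) ≤ (2 : ℝ) ^ 15 * (lam : ℝ) ^ 8 := by
    have : ((M.natAbs : ℕ) : ℤ) ≤ 2 ^ 15 * (lam : ℤ) ^ 8 := by
      rw [Int.natAbs_of_nonneg hM0.le]; exact hM
    exact_mod_cast this
  have hd := hC M.natAbs (by simpa using hM0.ne')
  have hd2 : (M.natAbs.divisors.card : ℝ) ≤ C * (((2 : ℝ) ^ 15) ^ (ε / 16) * (lam : ℝ) ^ (ε / 2)) := by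
    refine hd.trans (mul_le_mul_of_nonneg_left ?_ (by linarith))
    calc (M.natAbs : ℝ) ^ (ε / 16) ≤ ((2 : ℝ) ^ 15 * (lam : ℝ) ^ 8) ^ (ε / 16) :=
          Real.rpow_le_rpow (by positivity) hMn (by positivity)
      _ = _ := by
          rw [Real.mul_rpow (by positivity) (by positivity), ← Real.rpow_natCast (lam : ℝ) 8,
            ← Real.rpow_mul (by positivity)]
          congr 2; push_cast; ring
  calc (S.card : ℝ) ≤ 10 * (M.natAbs.divisors.card : ℝ) ^ 2 := by exact_mod_cast hcard
    _ ≤ 10 * (C * (((2 : ℝ) ^ 15) ^ (ε / 16) * (lam : ℝ) ^ (ε / 2))) ^ 2 := by gcongr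
    _ = K * ((lam : ℝ) ^ (ε / 2)) ^ 2 := by rw [hK]; ring
    _ = K * (lam : ℝ) ^ ε := by
        rw [← Real.rpow_natCast, ← Real.rpow_mul (by positivity)]; congr 2; push_cast; ring

/-! ### Simplicial covers adapted to an arrangement of hyperplanes -/

section Arrangement

variable {ι E : Type} [NormedAddCommGroup E] [NormedSpace ℝ E]

/-- `x` is the only common zero of some `d` members of the family `f`. -/
def IsArrangementVertex (f : ι → E →ᵃ[ℝ] ℝ) (d : ℕ) (x : E) : Prop :=
  ∃ J : Fin d → ι, ∀ y, (∀ k, f (J k) y = 0) ↔ y = x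

/-- The closed cell of the arrangement of the zero sets of `f` with sign vector `σ`. -/
def closedCell (f : ι → E →ᵃ[ℝ] ℝ) (σ : ι → SignType) : Set E :=
  {x | ∀ i, 0 ≤ (σ i : ℝ) * f i x}

theorem AffineMap.apply_add_smul (g : E →ᵃ[ℝ] ℝ) (x u : E) (t : ℝ) :
    g (x + t • u) = g x + t * g.linear u := by
  have := g.map_vadd x (t • u)
  rw [vadd_eq_add, vadd_eq_add, map_smul, smul_eq_mul] at this
  rw [add_comm x, this, add_comm]

theorem AffineMap.linear_sub_eq (g : E →ᵃ[ℝ] ℝ) (x y : E) : g.linear (x - y) = g x - g y := by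
  have := g.linearMap_vsub x y
  simpa using this

theorem convex_closedCell (f : ι → E →ᵃ[ℝ] ℝ) (σ : ι → SignType) : Convex ℝ (closedCell f σ) := by
  intro x hx y hy a b ha hb hab i
  have h : f i (a • x + b • y) = a * f i x + b * f i y := by
    rw [Convex.combo_affine_apply hab]; simp
  rw [h]
  have h1 := mul_nonneg ha (hx i)
  have h2 := mul_nonneg hb (hy i)
  nlinarith

/-- A functional vanishing on the hyperplane `h = 0` has the same sign at points where `h` has
the same sign. -/
theorem sign_eq_of_vanish {g h : E →ᵃ[ℝ] ℝ} (hgh : ∀ x, h x = 0 → g x = 0) {p q : E}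
    (hpq : SignType.sign (h p) = SignType.sign (h q)) (hz : ∃ x, h x = 0) :
    SignType.sign (g p) = SignType.sign (g q) := by
  by_cases hp : h p = 0
  · have hq : h q = 0 := by rw [hp, sign_zero] at hpq; exact sign_eq_zero_iff.1 hpq.symm
    rw [hgh p hp, hgh q hq]
  obtain ⟨z, hz⟩ := hz
  -- the ray from `z` through `p` meets the level set of `q`
  have hlin : g q * h p = g p * h q := by
    have h1 : h (q + (-(h q) / h p) • (p - z)) = 0 := by
      rw [AffineMap.apply_add_smul, AffineMap.linear_sub_eq, hz]; field_simp; ring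
    have h2 := hgh _ h1
    rw [AffineMap.apply_add_smul, AffineMap.linear_sub_eq, hgh z hz] at h2
    field_simp at h2
    linarith
  have h3 : SignType.sign (g q) * SignType.sign (h p) = SignType.sign (g p) * SignType.sign (h q) := by
    rw [← sign_mul, ← sign_mul, hlin]
  rw [← hpq] at h3
  exact (mul_right_cancel₀ (sign_ne_zero.2 hp) h3).symm

variable [FiniteDimensional ℝ E]

theorem isClosed_closedCell (f : ι → E →ᵃ[ℝ] ℝ) (σ : ι → SignType) :
    IsClosed (closedCell f σ) := by
  have : closedCell f σ = ⋂ i, {x | 0 ≤ (σ i : ℝ) * f i x} := by ext; simp [closedCell]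
  rw [this]
  exact isClosed_iInter fun i =>
    isClosed_le continuous_const (continuous_const.mul (f i).continuous_of_finiteDimensional)

/-- A point of a closed cell may be moved slightly in a direction that is tangent to all the
hyperplanes through it. -/
theorem exists_pos_add_smul_mem_closedCell [Fintype ι] {f : ι → E →ᵃ[ℝ] ℝ} {σ : ι → SignType} {x u : E}
    (hx : x ∈ closedCell f σ) (hu : ∀ i, f i x = 0 → (f i).linear u = 0) :
    ∃ t : ℝ, 0 < t ∧ x + t • u ∈ closedCell f σ := by
  have hev : ∀ i, ∀ᶠ t in nhdsWithin (0 : ℝ) (Set.Ioi 0), 0 ≤ (σ i : ℝ) * f i (x + t • u) := by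
    intro i
    rcases (hx i).lt_or_eq with h | h
    · have hc : Continuous fun t : ℝ => (σ i : ℝ) * f i (x + t • u) := by
        have : Continuous (f i) := (f i).continuous_of_finiteDimensional
        fun_prop
      have : ∀ᶠ t in nhds (0 : ℝ), 0 < (σ i : ℝ) * f i (x + t • u) :=
        hc.continuousAt.eventually (lt_mem_nhds (by simpa using h))
      exact (this.filter_mono nhdsWithin_le_nhds).mono fun t ht => ht.le
    · rcases mul_eq_zero.1 h.symm with h0 | h0
      · exact Filter.Eventually.of_forall fun t => by rw [h0, zero_mul]
      · exact Filter.Eventually.of_forall fun t => by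
          rw [AffineMap.apply_add_smul, hu i h0, h0]; simp
  obtain ⟨t, ht, ht0⟩ := ((Filter.eventually_all.2 hev).and self_mem_nhdsWithin).exists
  exact ⟨t, ht0, ht⟩

/-- A compact cell has an extreme point. A nonzero direction tangent to all hyperplanes through it
could be followed both ways inside the cell; so the linear parts of those functionals span the dual,
and d of them form a basis. -/
theorem exists_vertex_mem_closedCell [Fintype ι] {f : ι → E →ᵃ[ℝ] ℝ} {σ : ι → SignType} {d : ℕ}
    (hd : Module.finrank ℝ E = d) (hne : (closedCell f σ).Nonempty)
    (hb : Bornology.IsBounded (closedCell f σ)) :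
    ∃ x ∈ closedCell f σ, IsArrangementVertex f d x := by
  have hcpt : IsCompact (closedCell f σ) :=
    Metric.isCompact_of_isClosed_isBounded (isClosed_closedCell f σ) hb
  obtain ⟨x, hx⟩ := hcpt.extremePoints_nonempty hne
  rw [mem_extremePoints] at hx
  obtain ⟨hxK, hext⟩ := hx
  have hker : ∀ u : E, (∀ i, f i x = 0 → (f i).linear u = 0) → u = 0 := by
    intro u hu
    obtain ⟨t, ht, h1⟩ := exists_pos_add_smul_mem_closedCell hxK hu
    obtain ⟨s, hs, h2⟩ := exists_pos_add_smul_mem_closedCell (u := -u) hxK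
      (fun i hi => by rw [map_neg, hu i hi, neg_zero])
    have hmem : x ∈ openSegment ℝ (x + t • u) (x + s • (-u)) := by
      refine ⟨s / (s + t), t / (s + t), by positivity, by positivity, by field_simp, ?_⟩
      have hst : s + t ≠ 0 := by positivity
      have h1 : s / (s + t) + t / (s + t) = 1 := by field_simp
      calc (s / (s + t)) • (x + t • u) + (t / (s + t)) • (x + s • -u)
          = (s / (s + t) + t / (s + t)) • x + (s / (s + t) * t - t / (s + t) * s) • u := by module
        _ = x := by rw [h1, one_smul]; field_simp; simp
    have := (hext _ h1 _ h2 hmem).1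
    have h3 : t • u = 0 := by simpa using this
    exact (smul_eq_zero.1 h3).resolve_left ht.ne'
  set s : Set (Module.Dual ℝ E) := (fun i => (f i).linear) '' {i | f i x = 0} with hs
  have hspan : Submodule.span ℝ s = ⊤ := by
    have hco : (Submodule.span ℝ s).dualCoannihilator = ⊥ := by
      rw [eq_bot_iff]
      intro u hu
      rw [Submodule.mem_dualCoannihilator] at hu
      exact hker u fun i hi => hu _ (Submodule.subset_span ⟨i, hi, rfl⟩)
    rw [← Subspace.dualCoannihilator_dualAnnihilator_eq (W := Submodule.span ℝ s), hco]
    simp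
  obtain ⟨g, hg, hgs, -⟩ := Submodule.exists_fun_fin_finrank_span_eq ℝ s
  have hfr : d = Module.finrank ℝ (Submodule.span ℝ s) := by
    rw [hspan, finrank_top, Subspace.dual_finrank_eq, hd]
  choose J hJ1 hJ2 using fun k : Fin d => hg (Fin.cast hfr k)
  refine ⟨x, hxK, J, fun y => ⟨fun hy => ?_, fun hy k => ?_⟩⟩
  · have hz : ∀ φ ∈ Submodule.span ℝ s, φ (y - x) = 0 := by
      rw [← hgs]
      intro φ hφ
      induction hφ using Submodule.span_induction with
      | mem φ hφ =>
        obtain ⟨k, rfl⟩ := hφ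
        have := hJ2 (Fin.cast hfr.symm k)
        simp only [Fin.cast_cast, Fin.cast_eq_self] at this
        rw [← this, AffineMap.linear_sub_eq, hy, hJ1, sub_zero]
      | zero => simp
      | add a b _ _ ha hb => simp [ha, hb]
      | smul c a _ ha => simp [ha]
    exact sub_eq_zero.1 (hker _ fun i _ => hz _ (by rw [hspan]; trivial))
  · rw [hy]; exact hJ1 k

/-- This permits a closed covering statement to be checked only at points in general position. -/
theorem dense_generic {κ : Type} [Finite κ] (g : κ → E →ᵃ[ℝ] ℝ) :
    Dense {q | ∀ k, g k q ≠ 0 ∨ ∀ x, g k x = 0} := by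
  have hset : {q | ∀ k, g k q ≠ 0 ∨ ∀ x, g k x = 0} = ⋂ k, {q | g k q ≠ 0 ∨ ∀ x, g k x = 0} := by
    ext; simp
  have : ProperSpace E := FiniteDimensional.proper ℝ E
  rw [hset]
  refine dense_iInter_of_isOpen (fun k => ?_) (fun k => ?_)
  all_goals by_cases h : ∀ x, g k x = 0
  · simp [h]
  · simp only [h, or_false]
    exact isOpen_ne_fun (g k).continuous_of_finiteDimensional continuous_const
  · simp [h]
  · simp only [h, or_false]
    push Not at h
    obtain ⟨x, hx⟩ := h
    intro q
    by_cases hq : g k q = 0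
    · have hc : Continuous fun t : ℝ => q + t • (x - q) := by fun_prop
      have ht : Filter.Tendsto (fun t : ℝ => q + t • (x - q)) (nhdsWithin 0 (Set.Ioi 0)) (nhds q) := by
        have := hc.tendsto 0
        simp only [zero_smul, add_zero] at this
        exact this.mono_left nhdsWithin_le_nhds
      refine mem_closure_of_tendsto ht ?_
      filter_upwards [self_mem_nhdsWithin] with t ht
      rw [AffineMap.apply_add_smul, AffineMap.linear_sub_eq, hq]
      simpa using ⟨(Set.mem_Ioi.1 ht).ne', hx⟩
    · exact subset_closure hq

/-- The ray from `v` through a point `q` of a bounded cell, in generic position, leaves the cell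
through one of the hyperplanes. -/
theorem exists_exit_point [Fintype ι] {f : ι → E →ᵃ[ℝ] ℝ} {v q : E}
    (hb : Bornology.IsBounded (closedCell f (fun i => SignType.sign (f i q))))
    (hvq : v ≠ q)
    (hq : ∀ i, f i q ≠ 0 ∨ ∀ x, f i x = 0) :
    ∃ (i : ι) (c : ℝ), 1 ≤ c ∧ v + c • (q - v) ∈ closedCell f (fun i => SignType.sign (f i q)) ∧
      f i (v + c • (q - v)) = 0 ∧ f i v ≠ 0 ∧ f i q ≠ 0 ∧ (f i).linear ≠ 0 := by
  set K := closedCell f (fun i => SignType.sign (f i q)) with hK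
  have hqK : q ∈ K := fun i => by
    have := sign_mul_self (f i q)
    simp only [this]
    exact abs_nonneg _
  have hKc : IsClosed K := isClosed_closedCell f _
  have hu : q - v ≠ 0 := sub_ne_zero.2 hvq.symm
  let γ : ℝ → E := fun c => v + c • (q - v)
  have hγ : Continuous γ := by fun_prop
  have hScpt : IsCompact (Set.Ici (1 : ℝ) ∩ γ ⁻¹' K) := by
    refine Metric.isCompact_of_isClosed_isBounded (isClosed_Ici.inter (hKc.preimage hγ)) ?_
    obtain ⟨R, hR⟩ := isBounded_iff_forall_norm_le.1 hb
    refine isBounded_iff_forall_norm_le.2 ⟨(R + ‖v‖) / ‖q - v‖, fun c hc => ?_⟩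
    have hn : 0 < ‖q - v‖ := norm_pos_iff.2 hu
    rw [le_div_iff₀ hn, ← norm_smul]
    calc ‖c • (q - v)‖ = ‖γ c - v‖ := by simp [γ]
      _ ≤ ‖γ c‖ + ‖v‖ := norm_sub_le _ _
      _ ≤ R + ‖v‖ := by gcongr; exact hR _ hc.2
  have hγ1 : γ 1 = q := by simp [γ]
  -- The last parameter for which the ray is in the cell. If every functional vanishing there also
  -- vanished at the generic point q, all of them would be identically zero and the ray could be
  -- prolonged.
  obtain ⟨c, ⟨hc1, hcK⟩, hmax⟩ := hScpt.exists_isGreatest ⟨1, Set.self_mem_Ici, by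
    rw [Set.mem_preimage, hγ1]; exact hqK⟩
  have hex : ∃ i, f i (γ c) = 0 ∧ f i q ≠ 0 := by
    by_contra! hno
    have hx : ∀ i, f i (γ c) = 0 → ∀ x, f i x = 0 := fun i hi =>
      (hq i).resolve_left (not_not.2 (hno i hi))
    obtain ⟨t, ht, hmem⟩ := exists_pos_add_smul_mem_closedCell (u := q - v) hcK fun i hi => by
      rw [AffineMap.linear_sub_eq, hx i hi, hx i hi, sub_self]
    have : γ c + t • (q - v) = γ (c + t) := by simp only [γ]; module
    rw [this] at hmem
    have := hmax ⟨by rw [Set.mem_Ici] at hc1 ⊢; linarith, hmem⟩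
    linarith
  obtain ⟨i, hi0, hiq⟩ := hex
  have hlin : f i v + c * (f i q - f i v) = 0 := by
    rw [← AffineMap.linear_sub_eq, ← AffineMap.apply_add_smul]; exact hi0
  have hc0 : (0 : ℝ) < c := lt_of_lt_of_le one_pos hc1
  have hiv : f i v ≠ 0 := by
    intro h
    rw [h] at hlin
    simp only [sub_zero, zero_add, mul_eq_zero] at hlin
    exact hlin.elim hc0.ne' hiq
  refine ⟨i, c, hc1, hcK, hi0, hiv, hiq, fun h => ?_⟩
  have : f i q - f i v = 0 := by rw [← AffineMap.linear_sub_eq, h]; rfl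
  rw [this] at hlin
  exact hiv (by linarith)

end Arrangement

/-! ### Fan triangulation of the cells, by induction on the dimension -/

section Cover

variable {ι E : Type} [NormedAddCommGroup E] [NormedSpace ℝ E]

/-- `T` is a family of simplices with vertices in the arrangement, each inside a closed cell,
which cover the interior of the polytope cut out by the functionals in `B`. -/
structure IsSimplexCover (f : ι → E →ᵃ[ℝ] ℝ) (B : Finset ι) (d : ℕ)
    (T : Finset (Finset E × (ι → SignType))) : Prop where
  card_le : ∀ t ∈ T, t.1.card ≤ d + 1
  vertex : ∀ t ∈ T, ∀ v ∈ t.1, IsArrangementVertex f d v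
  mem_cell : ∀ t ∈ T, ∀ v ∈ t.1, v ∈ closedCell f t.2
  sign_eq_zero : ∀ t ∈ T, ∀ i, t.2 i = 0 ↔ ∀ x, f i x = 0
  cover : ∀ q, (∀ i ∈ B, 0 < f i q ∨ ∀ x, f i x = 0) → ∃ t ∈ T, q ∈ convexHull ℝ (t.1 : Set E)

/-- `T` is a family of simplices as in `IsSimplexCover`, but inside the hyperplane `f i = 0`. -/
structure IsFacetCover (f : ι → E →ᵃ[ℝ] ℝ) (B : Finset ι) (d : ℕ) (i : ι)
    (T : Finset (Finset E × (ι → SignType))) : Prop where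
  card_le : ∀ t ∈ T, t.1.card ≤ d + 1
  vertex : ∀ t ∈ T, ∀ v ∈ t.1, IsArrangementVertex f (d + 1) v
  apply_eq_zero : ∀ t ∈ T, ∀ v ∈ t.1, f i v = 0
  mem_cell : ∀ t ∈ T, ∀ v ∈ t.1, v ∈ closedCell f t.2
  sign_eq_zero : ∀ t ∈ T, ∀ j, t.2 j = 0 ↔ ∀ x, f i x = 0 → f j x = 0
  cover : ∀ q, f i q = 0 → (∀ j ∈ B, 0 < f j q ∨ ∀ x, f i x = 0 → f j x = 0) →
    ∃ t ∈ T, q ∈ convexHull ℝ (t.1 : Set E)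

theorem IsSimplexCover.of_finrank_zero [DecidableEq E] {f : ι → E →ᵃ[ℝ] ℝ} {B : Finset ι} [Subsingleton E] :
    IsSimplexCover f B 0 {({0}, fun i => SignType.sign (f i 0))} where
  card_le := by simp
  vertex := by
    rintro t - v -
    exact ⟨Fin.elim0, fun y => ⟨fun _ => Subsingleton.elim _ _, fun _ k => k.elim0⟩⟩
  mem_cell := by
    intro t ht v _ i
    rw [Finset.mem_singleton] at ht
    have := sign_mul_self (f i 0)
    rw [ht, Subsingleton.elim v 0]
    simp only [this]
    exact abs_nonneg _
  sign_eq_zero := by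
    intro t ht i
    rw [Finset.mem_singleton] at ht
    rw [ht, sign_eq_zero_iff]
    exact ⟨fun h x => by rwa [Subsingleton.elim x 0], fun h => h 0⟩
  cover := by
    intro q _
    exact ⟨_, Finset.mem_singleton_self _, by simp [Subsingleton.elim q 0]⟩

variable [FiniteDimensional ℝ E]

/-- The arrangement is restricted to the hyperplane, identified with ker (f i).linear by a
translation. A vertex of the restriction is a vertex of the original once f i joins its list of
functionals. -/
theorem exists_isFacetCover {d N : ℕ} {B : Finset ι}
    (ih : ∀ (E' : Type) [NormedAddCommGroup E'] [NormedSpace ℝ E'] [FiniteDimensional ℝ E'],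
      Module.finrank ℝ E' = d → ∀ f : ι → E' →ᵃ[ℝ] ℝ,
      Bornology.IsBounded {x | ∀ i ∈ B, 0 ≤ f i x} → ∃ T, T.card ≤ N ∧ IsSimplexCover f B d T)
    (hd : Module.finrank ℝ E = d + 1) (f : ι → E →ᵃ[ℝ] ℝ)
    (hb : Bornology.IsBounded {x | ∀ i ∈ B, 0 ≤ f i x}) (i : ι) (hi : (f i).linear ≠ 0) :
    ∃ T, T.card ≤ N ∧ IsFacetCover f B d i T := by
  classical
  obtain ⟨u, hu⟩ : ∃ u, (f i).linear u ≠ 0 := by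
    by_contra! h; exact hi (LinearMap.ext h)
  obtain ⟨z, hz⟩ : ∃ z, f i z = 0 := by
    refine ⟨0 + (-(f i 0) / (f i).linear u) • u, ?_⟩
    rw [AffineMap.apply_add_smul]; field_simp; ring
  let W := LinearMap.ker (f i).linear
  let g : W →ᵃ[ℝ] E := W.subtype.toAffineMap + AffineMap.const ℝ W z
  have hg : ∀ y : W, g y = (y : E) + z := fun y => by simp [g]
  have hfg : ∀ y : W, f i (g y) = 0 := by
    intro y
    have h1 : (f i).linear (y : E) = 0 := y.2
    have := AffineMap.apply_add_smul (f i) z (y : E) 1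
    rw [one_smul, h1, hz] at this
    rw [hg, add_comm, this]; ring
  have hsurj : ∀ x, f i x = 0 → ∃ y : W, g y = x := by
    intro x hx
    refine ⟨⟨x - z, ?_⟩, by rw [hg]; simp⟩
    rw [LinearMap.mem_ker, AffineMap.linear_sub_eq, hx, hz, sub_zero]
  have hinj : Function.Injective g := by
    intro x y h
    rw [hg, hg] at h
    exact Subtype.ext (add_right_cancel h)
  have hW : Module.finrank ℝ W = d := by
    have := Module.Dual.finrank_ker_add_one_of_ne_zero hi
    change Module.finrank ℝ W + 1 = _ at this
    omega
  obtain ⟨T, hTN, hT⟩ := ih W hW (fun j => (f j).comp g) (by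
    obtain ⟨R, hR⟩ := isBounded_iff_forall_norm_le.1 hb
    refine isBounded_iff_forall_norm_le.2 ⟨R + ‖z‖, fun y hy => ?_⟩
    calc ‖y‖ = ‖g y - z‖ := by rw [hg]; simp
      _ ≤ ‖g y‖ + ‖z‖ := norm_sub_le _ _
      _ ≤ R + ‖z‖ := by gcongr; exact hR _ hy)
  have hvan : ∀ j, (∀ y : W, f j (g y) = 0) ↔ ∀ x, f i x = 0 → f j x = 0 := by
    intro j
    refine ⟨fun h x hx => ?_, fun h y => h _ (hfg y)⟩
    obtain ⟨y, rfl⟩ := hsurj x hx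
    exact h y
  let m : Finset W × (ι → SignType) → Finset E × (ι → SignType) := fun t => (t.1.image g, t.2)
  refine ⟨T.image m, Finset.card_image_le.trans hTN, ?_, ?_, ?_, ?_, ?_, ?_⟩
  · intro t ht
    obtain ⟨t, htT, rfl⟩ := Finset.mem_image.1 ht
    exact Finset.card_image_le.trans (hT.card_le t htT)
  · intro t ht v hv
    obtain ⟨t, htT, rfl⟩ := Finset.mem_image.1 ht
    obtain ⟨v, hvt, rfl⟩ := Finset.mem_image.1 hv
    obtain ⟨J, hJ⟩ := hT.vertex t htT v hvt
    refine ⟨Fin.cons i J, fun y => ⟨fun hy => ?_, ?_⟩⟩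
    · obtain ⟨y, rfl⟩ := hsurj y (by simpa using hy 0)
      rw [(hJ y).1 fun k => by simpa using hy k.succ]
    · rintro rfl k
      refine Fin.cases ?_ (fun k => ?_) k
      · simpa using hfg v
      · simpa using (hJ v).2 rfl k
  · intro t ht v hv
    obtain ⟨t, htT, rfl⟩ := Finset.mem_image.1 ht
    obtain ⟨v, hvt, rfl⟩ := Finset.mem_image.1 hv
    exact hfg v
  · intro t ht v hv
    obtain ⟨t, htT, rfl⟩ := Finset.mem_image.1 ht
    obtain ⟨v, hvt, rfl⟩ := Finset.mem_image.1 hv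
    exact hT.mem_cell t htT v hvt
  · intro t ht j
    obtain ⟨t, htT, rfl⟩ := Finset.mem_image.1 ht
    rw [← hvan]
    exact hT.sign_eq_zero t htT j
  · intro q hq hqB
    obtain ⟨y, rfl⟩ := hsurj q hq
    obtain ⟨t, ht, hyt⟩ := hT.cover y fun j hj => by
      rcases hqB j hj with h | h
      · exact Or.inl h
      · exact Or.inr ((hvan j).2 h)
    refine ⟨m t, Finset.mem_image_of_mem m ht, ?_⟩
    simp only [m, Finset.coe_image]
    rw [← AffineMap.image_convexHull]
    exact ⟨y, hyt, rfl⟩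

/-- An arrangement of hyperplanes in dimension `d` has a simplicial cover by `O(|ι| ^ d)` simplices. -/
theorem exists_isSimplexCover [Fintype ι] (B : Finset ι) (d : ℕ) :
    ∀ (E : Type) [NormedAddCommGroup E] [NormedSpace ℝ E] [FiniteDimensional ℝ E],
      Module.finrank ℝ E = d → ∀ f : ι → E →ᵃ[ℝ] ℝ,
      Bornology.IsBounded {x | ∀ i ∈ B, 0 ≤ f i x} →
      ∃ T, T.card ≤ (2 * Fintype.card ι) ^ d ∧ IsSimplexCover f B d T := by
  classical
  induction d with
  | zero =>
    intro E _ _ _ hE f _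
    have : Subsingleton E := Module.finrank_zero_iff.1 hE
    exact ⟨_, by simp, IsSimplexCover.of_finrank_zero⟩
  | succ d ih =>
    intro E _ _ _ hE f hb
    have hfac : ∀ i, ∃ T : Finset (Finset E × (ι → SignType)), T.card ≤ (2 * Fintype.card ι) ^ d ∧
        ((f i).linear ≠ 0 → IsFacetCover f B d i T) := by
      intro i
      by_cases hi : (f i).linear ≠ 0
      · obtain ⟨T, h1, h2⟩ := exists_isFacetCover ih hE f hb i hi
        exact ⟨T, h1, fun _ => h2⟩
      · exact ⟨∅, by simp, fun h => absurd h hi⟩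
    choose S hScard hS using hfac
    -- a point on each side of each hyperplane
    have hside : ∀ (i : ι) (s : Bool), ∃ y : E, (∃ x, SignType.sign (f i x) = if s then 1 else -1) →
        SignType.sign (f i y) = if s then 1 else -1 := by
      intro i s
      by_cases h : ∃ x, SignType.sign (f i x) = if s then 1 else -1
      · exact ⟨h.choose, fun _ => h.choose_spec⟩
      · exact ⟨0, fun h' => absurd h' h⟩
    choose y hy using hside
    -- an apex in each cell
    have hapex : ∀ σ : ι → SignType, ∃ v : E,
        (∃ x ∈ closedCell f σ, IsArrangementVertex f (d + 1) x) →
          v ∈ closedCell f σ ∧ IsArrangementVertex f (d + 1) v := by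
      intro σ
      by_cases h : ∃ x ∈ closedCell f σ, IsArrangementVertex f (d + 1) x
      · exact ⟨h.choose, fun _ => h.choose_spec⟩
      · exact ⟨0, fun h' => absurd h' h⟩
    choose apex hapex using hapex
    -- A facet simplex and a side of its hyperplane determine the cell: nonzero facet labels carry
    -- over, and a functional vanishing on the hyperplane has one sign on each side. The cones are
    -- therefore indexed by facet simplices and sides, which gives the factor 2 |ι| per dimension.
    let lab : (Σ _ : ι, Finset E × (ι → SignType)) × Bool → ι → SignType := fun p j =>
      if p.1.2.2 j = 0 then SignType.sign (f j (y p.1.1 p.2)) else p.1.2.2 j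
    let mk : (Σ _ : ι, Finset E × (ι → SignType)) × Bool → Finset E × (ι → SignType) := fun p =>
      (insert (apex (lab p)) p.1.2.1, lab p)
    -- Some pairs may give junk cones, for instance with the default apex 0. Filtering removes them,
    -- so only coverage needs an argument.
    let ok : Finset E × (ι → SignType) → Prop := fun t =>
      t.1.card ≤ d + 2 ∧ (∀ v ∈ t.1, IsArrangementVertex f (d + 1) v) ∧
      (∀ v ∈ t.1, v ∈ closedCell f t.2) ∧ ∀ i, t.2 i = 0 ↔ ∀ x, f i x = 0
    let T := (((Finset.univ.sigma S) ×ˢ (Finset.univ : Finset Bool)).image mk).filter ok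
    have hTok : ∀ t ∈ T, ok t := fun t ht => (Finset.mem_filter.1 ht).2
    refine ⟨T, ?_, fun t ht => (hTok t ht).1, fun t ht => (hTok t ht).2.1,
      fun t ht => (hTok t ht).2.2.1, fun t ht => (hTok t ht).2.2.2, ?_⟩
    · calc T.card ≤ ((Finset.univ.sigma S) ×ˢ (Finset.univ : Finset Bool)).card :=
            (Finset.card_filter_le _ _).trans Finset.card_image_le
        _ = (∑ i, (S i).card) * 2 := by rw [Finset.card_product, Finset.card_sigma]; simp
        _ ≤ (∑ _i : ι, (2 * Fintype.card ι) ^ d) * 2 := by gcongr with i; exact hScard i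
        _ = (2 * Fintype.card ι) ^ (d + 1) := by simp; ring
    -- it suffices to cover a dense set of points
    let gen : ι ⊕ ((ι → SignType) × ι × ι) → E →ᵃ[ℝ] ℝ := Sum.elim f fun p =>
      f p.2.2 (apex p.1) • f p.2.1 - f p.2.1 (apex p.1) • f p.2.2
    have hdense := dense_generic gen
    let U : Set E := ⋃ t ∈ T, convexHull ℝ (t.1 : Set E)
    have hU : IsClosed U := by
      refine T.finite_toSet.isClosed_biUnion fun t _ => ?_
      exact (t.1.finite_toSet.isCompact_convexHull ℝ).isClosed
    let O : Set E := {q | ∀ i ∈ B, 0 < f i q ∨ ∀ x, f i x = 0}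
    have hO : IsOpen O := by
      have : O = ⋂ i ∈ B, {q | 0 < f i q ∨ ∀ x, f i x = 0} := by ext; simp [O]
      rw [this]
      refine isOpen_biInter_finset fun i _ => ?_
      by_cases h : ∀ x, f i x = 0
      · simp [h]
      · simp only [h, or_false]
        exact isOpen_lt continuous_const (f i).continuous_of_finiteDimensional
    suffices hgen : O ∩ {q | ∀ k, gen k q ≠ 0 ∨ ∀ x, gen k x = 0} ⊆ U by
      intro q hq
      have h1 : q ∈ closure (O ∩ {q | ∀ k, gen k q ≠ 0 ∨ ∀ x, gen k x = 0}) :=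
        hdense.open_subset_closure_inter hO hq
      have h2 := closure_minimal hgen hU h1
      simpa [U] using h2
    rintro q ⟨hqO, hqG⟩
    have hqf : ∀ i, f i q ≠ 0 ∨ ∀ x, f i x = 0 := fun i => hqG (Sum.inl i)
    set σ : ι → SignType := fun i => SignType.sign (f i q) with hσ
    have hσ0 : ∀ i, σ i = 0 ↔ ∀ x, f i x = 0 := by
      intro i
      rw [hσ, sign_eq_zero_iff]
      exact ⟨fun h => (hqf i).resolve_left (not_not.2 h), fun h => h q⟩
    have hqσ : q ∈ closedCell f σ := fun i => by
      have := sign_mul_self (f i q)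
      simp only [hσ, this]
      exact abs_nonneg _
    have hσB : ∀ x ∈ closedCell f σ, ∀ i ∈ B, 0 ≤ f i x := by
      intro x hx i hi
      rcases hqO i hi with h | h
      · have := hx i
        simpa [hσ, sign_pos h] using this
      · exact (h x).ge
    have hσb : Bornology.IsBounded (closedCell f σ) := hb.subset hσB
    obtain ⟨hvσ, hvV⟩ := hapex σ (exists_vertex_mem_closedCell hE ⟨q, hqσ⟩ hσb)
    set v := apex σ with hv
    have hvq : v ≠ q := by
      rintro h
      obtain ⟨J, hJ⟩ := hvV
      have h0 : ∀ k x, f (J k) x = 0 := fun k =>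
        (hqf (J k)).resolve_left (not_not.2 (by rw [← h]; exact (hJ v).2 rfl k))
      have : Subsingleton E := ⟨fun a b => by
        rw [(hJ a).1 fun k => h0 k a, (hJ b).1 fun k => h0 k b]⟩
      rw [Module.finrank_zero_of_subsingleton] at hE
      omega
    obtain ⟨i, c, hc1, hq1σ, hq1, hiv, hiq, hilin⟩ := exists_exit_point hσb hvq hqf
    set q1 := v + c • (q - v) with hq1def
    have hc0 : 0 < c := lt_of_lt_of_le one_pos hc1
    -- The ray from v meets both hyperplanes at q1, so f j(v) f i − f i(v) f j vanishes at q, hence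
    -- identically by genericity; and f i(v) ≠ 0.
    have hvan : ∀ j, f j q1 = 0 → ∀ x, f i x = 0 → f j x = 0 := by
      intro j hj
      have e1 : f i v + c * (f i q - f i v) = 0 := by
        rw [← AffineMap.linear_sub_eq, ← AffineMap.apply_add_smul]; exact hq1
      have e2 : f j v + c * (f j q - f j v) = 0 := by
        rw [← AffineMap.linear_sub_eq, ← AffineMap.apply_add_smul]; exact hj
      have e3 : f j v * f i q - f i v * f j q = 0 := by
        have : c * (f j v * f i q - f i v * f j q) = 0 := by
          linear_combination f j v * e1 - f i v * e2
        exact (mul_eq_zero.1 this).resolve_left hc0.ne'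
      have e4 : ∀ x, f j v * f i x - f i v * f j x = 0 := by
        rcases hqG (Sum.inr (σ, i, j)) with h | h
        · exact absurd e3 (by simpa [gen] using h)
        · intro x; simpa [gen] using h x
      intro x hx
      have := e4 x
      rw [hx] at this
      simpa [hiv] using this
    have hF := hS i hilin
    obtain ⟨t, htS, hq1t⟩ := hF.cover q1 hq1 fun j hj => by
      rcases (hσB _ hq1σ j hj).lt_or_eq with h | h
      · exact Or.inl h
      · exact Or.inr (hvan j h.symm)
    have hq1cell : q1 ∈ closedCell f t.2 :=
      convexHull_min (fun x hx => hF.mem_cell t htS x hx) (convex_closedCell f t.2) hq1t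
    obtain ⟨s, hs⟩ : ∃ s : Bool, SignType.sign (f i q) = if s then 1 else -1 := by
      rcases lt_or_gt_of_ne hiq with h | h
      · exact ⟨false, by simp [sign_neg h]⟩
      · exact ⟨true, by simp [sign_pos h]⟩
    have hlab : lab (⟨i, t⟩, s) = σ := by
      funext j
      by_cases htj : t.2 j = 0
      · have h1 := (hF.sign_eq_zero t htS j).1 htj
        have h2 : SignType.sign (f i (y i s)) = SignType.sign (f i q) := by
          rw [hs]; exact hy i s ⟨q, hs⟩
        simp only [lab, htj, if_true]
        exact sign_eq_of_vanish h1 h2 ⟨q1, hq1⟩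
      · simp only [lab, htj, if_false]
        have h1 : f j q1 ≠ 0 := fun h => htj ((hF.sign_eq_zero t htS j).2 (hvan j h))
        have h2 : σ j ≠ 0 := fun h => h1 ((hσ0 j).1 h q1)
        have h3 := hq1cell j
        have h4 := hq1σ j
        have key : ∀ a : SignType, a ≠ 0 → 0 ≤ (a : ℝ) * f j q1 → a = SignType.sign (f j q1) := by
          intro a ha h
          rcases lt_or_gt_of_ne h1 with hn | hp
          · rw [sign_neg hn]
            cases a
            · exact absurd rfl ha
            · rfl
            · simp at h; linarith
          · rw [sign_pos hp]
            cases a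
            · exact absurd rfl ha
            · simp at h; linarith
            · rfl
        rw [key _ htj h3, key _ h2 h4]
    have hmk : mk (⟨i, t⟩, s) = (insert v t.1, σ) := by simp only [mk, hlab, hv]
    have hmem : (insert v t.1, σ) ∈ T := by
      refine Finset.mem_filter.2 ⟨?_, ?_, ?_, ?_, hσ0⟩
      · rw [← hmk]
        exact Finset.mem_image_of_mem _ (by simp [htS])
      · have := hF.card_le t htS
        exact (Finset.card_insert_le _ _).trans (by omega)
      · intro x hx
        rcases Finset.mem_insert.1 hx with rfl | hx
        · exact hvV
        · exact hF.vertex t htS x hx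
      · intro x hx
        rcases Finset.mem_insert.1 hx with rfl | hx
        · exact hvσ
        · intro j
          by_cases htj : t.2 j = 0
          · rw [(hF.sign_eq_zero t htS j).1 htj x (hF.apply_eq_zero t htS x hx), mul_zero]
          · have h1 : σ j = t.2 j := by rw [← hlab]; simp [lab, htj]
            simp only [h1]
            exact hF.mem_cell t htS x hx j
    refine Set.mem_biUnion hmem ?_
    have hv1 : v ∈ convexHull ℝ ((insert v t.1 : Finset E) : Set E) :=
      subset_convexHull ℝ _ (by simp)
    have hq1' : q1 ∈ convexHull ℝ ((insert v t.1 : Finset E) : Set E) :=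
      convexHull_mono (by simp) hq1t
    have hcomb : q = (1 - 1 / c) • v + (1 / c) • q1 := by
      rw [hq1def, smul_add, smul_smul, one_div_mul_cancel hc0.ne']
      module
    rw [hcomb]
    exact (convex_convexHull ℝ _) hv1 hq1' (by rw [sub_nonneg, div_le_one hc0]; exact hc1)
      (by positivity) (by ring)

end Cover

/-! ### Cuttings by random sampling -/

theorem AffineMap.apply_sum_smul {E : Type} [AddCommGroup E] [Module ℝ E] (g : E →ᵃ[ℝ] ℝ) {s : Finset E}
    {a : E → ℝ} (ha : ∑ v ∈ s, a v = 1) : g (∑ v ∈ s, a v • v) = ∑ v ∈ s, a v * g v := by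
  have h : ∀ x, g x = g.linear x + g 0 := fun x => congrFun g.decomp x
  rw [h, map_sum]
  calc ∑ v ∈ s, g.linear (a v • v) + g 0 = ∑ v ∈ s, g.linear (a v • v) + (∑ v ∈ s, a v) * g 0 := by
        rw [ha, one_mul]
    _ = ∑ v ∈ s, a v * g v := by
        rw [Finset.sum_mul, ← Finset.sum_add_distrib]
        refine Finset.sum_congr rfl fun v _ => ?_
        rw [h v, map_smul, smul_eq_mul]; ring

/-- The functional `x ↦ R ± xᵢ`. -/
noncomputable def boxFunctional {d : ℕ} (R : ℝ) (p : Fin d × Bool) : (Fin d → ℝ) →ᵃ[ℝ] ℝ :=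
  ((if p.2 then (1 : ℝ) else -1) • (LinearMap.proj p.1 : (Fin d → ℝ) →ₗ[ℝ] ℝ)).toAffineMap +
    AffineMap.const ℝ _ R

theorem boxFunctional_apply {d : ℕ} (R : ℝ) (p : Fin d × Bool) (x : Fin d → ℝ) :
    boxFunctional R p x = (if p.2 then (1 : ℝ) else -1) * x p.1 + R := by
  rcases p with ⟨i, _ | _⟩ <;> simp [boxFunctional]

theorem exists_finset_vertices {ι : Type} [Fintype ι] {d : ℕ} (f : ι → (Fin d → ℝ) →ᵃ[ℝ] ℝ) :
    ∃ V : Finset (Fin d → ℝ), V.card ≤ Fintype.card ι ^ d ∧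
      ∀ v, IsArrangementVertex f d v → v ∈ V := by
  classical
  let pt : (Fin d → ι) → (Fin d → ℝ) := fun J =>
    if h : ∃ x, ∀ y, (∀ k, f (J k) y = 0) ↔ y = x then h.choose else 0
  refine ⟨Finset.univ.image pt, Finset.card_image_le.trans (by simp), fun v hv => ?_⟩
  obtain ⟨J, hJ⟩ := hv
  refine Finset.mem_image.2 ⟨J, Finset.mem_univ _, ?_⟩
  have h : ∃ x, ∀ y, (∀ k, f (J k) y = 0) ↔ y = x := ⟨v, hJ⟩
  simp only [pt, dif_pos h]
  exact (hJ _).1 ((h.choose_spec _).2 rfl)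

/-- A sample of `r` functionals hitting every large set in a finite collection of sets. -/
theorem exists_hitting_sample {α κ : Type} [Fintype α] (V : Finset κ) (sep : κ → Finset α)
    {r D : ℕ} (hr : V.card * (Fintype.card α - D) ^ r < Fintype.card α ^ r) :
    ∃ ρ : Fin r → α, ∀ v ∈ V, D < (sep v).card → ∃ k, ρ k ∈ sep v := by
  classical
  by_contra! hcon
  let bad : κ → Finset (Fin r → α) := fun v => Fintype.piFinset fun _ => (sep v)ᶜ
  have hcov : (Finset.univ : Finset (Fin r → α)) ⊆
      (V.filter fun v => D < (sep v).card).biUnion bad := by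
    intro ρ _
    obtain ⟨v, hv, hD, hk⟩ := hcon ρ
    exact Finset.mem_biUnion.2 ⟨v, Finset.mem_filter.2 ⟨hv, hD⟩,
      Fintype.mem_piFinset.2 fun k => Finset.mem_compl.2 (hk k)⟩
  have h1 : Fintype.card α ^ r ≤ V.card * (Fintype.card α - D) ^ r :=
    calc Fintype.card α ^ r = (Finset.univ : Finset (Fin r → α)).card := by simp
      _ ≤ _ := Finset.card_le_card hcov
      _ ≤ (V.filter fun v => D < (sep v).card).card * (Fintype.card α - D) ^ r := by
          refine Finset.card_biUnion_le_card_mul _ _ _ fun v hv => ?_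
          have := (Finset.mem_filter.1 hv).2
          simp only [bad, Fintype.card_piFinset, Finset.prod_const, Finset.card_univ, Fintype.card_fin,
            Finset.card_compl]
          exact Nat.pow_le_pow_left (by omega) r
      _ ≤ _ := Nat.mul_le_mul_right _ (Finset.card_filter_le _ _)
  omega

/-- The sample hits every set of more than D hyperplanes that separates two vertices of the full
arrangement. A simplex lies in a closed cell of the sample, so no sampled hyperplane separates two
of its vertices, and hence at most D hyperplanes do. The 2d sides of a box around Q provide
boundedness; there are at most (n + 2d)^{2d} pairs of vertices. -/
theorem exists_cutting {α : Type} [Fintype α] {d r D : ℕ} (f : α → (Fin d → ℝ) →ᵃ[ℝ] ℝ)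
    (hr : (Fintype.card α + 2 * d) ^ (2 * d) * (Fintype.card α - D) ^ r < Fintype.card α ^ r)
    (Q : Finset (Fin d → ℝ)) :
    ∃ T : Finset (Finset (Fin d → ℝ)), T.card ≤ (2 * (r + 2 * d)) ^ d ∧
      (∀ τ ∈ T, τ.card ≤ d + 1) ∧
      (∀ τ ∈ T, ∀ v ∈ τ, ∀ v' ∈ τ, (Finset.univ.filter fun p => f p v < 0 ∧ 0 < f p v').card ≤ D) ∧
      ∀ q ∈ Q, ∃ τ ∈ T, q ∈ convexHull ℝ (τ : Set (Fin d → ℝ)) := by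
  classical
  obtain ⟨R, hR⟩ : ∃ R : ℝ, ∀ q ∈ Q, ∀ i, |q i| < R := by
    obtain ⟨R, hR⟩ := isBounded_iff_forall_norm_le.1 Q.finite_toSet.isBounded
    exact ⟨R + 1, fun q hq i => lt_of_le_of_lt ((norm_le_pi_norm q i).trans (hR q hq)) (by linarith)⟩
  let box := Sum.elim f (boxFunctional (d := d) R)
  obtain ⟨V, hVcard, hV⟩ := exists_finset_vertices box
  obtain ⟨ρ, hρ⟩ := exists_hitting_sample (V ×ˢ V)
    (fun w => Finset.univ.filter fun p => f p w.1 < 0 ∧ 0 < f p w.2) (r := r) (D := D) (by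
      refine lt_of_le_of_lt (Nat.mul_le_mul_right _ ?_) hr
      rw [Finset.card_product]
      calc V.card * V.card ≤ Fintype.card (α ⊕ Fin d × Bool) ^ d * Fintype.card (α ⊕ Fin d × Bool) ^ d :=
            Nat.mul_le_mul hVcard hVcard
        _ = _ := by
            rw [← pow_add, ← two_mul]; simp [mul_comm d 2])
  let g : Fin r ⊕ Fin d × Bool → (Fin d → ℝ) →ᵃ[ℝ] ℝ := Sum.elim (f ∘ ρ) (boxFunctional R)
  have hg : ∀ i, g i = box (Sum.map ρ id i) := by rintro (i | i) <;> rfl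
  let B : Finset (Fin r ⊕ Fin d × Bool) := Finset.univ.image Sum.inr
  have hbdd : Bornology.IsBounded {x : Fin d → ℝ | ∀ i ∈ B, 0 ≤ g i x} := by
    refine isBounded_iff_forall_norm_le.2 ⟨|R|, fun x hx => ?_⟩
    refine (pi_norm_le_iff_of_nonneg (abs_nonneg R)).2 fun i => ?_
    have h1 := hx (Sum.inr (i, true)) (by simp [B])
    have h2 := hx (Sum.inr (i, false)) (by simp [B])
    simp only [g, Sum.elim_inr, boxFunctional_apply] at h1 h2
    norm_num at h1 h2
    rw [Real.norm_eq_abs]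
    exact (abs_le.2 ⟨by linarith, by linarith⟩).trans (le_abs_self R)
  obtain ⟨T, hTcard, hT⟩ := exists_isSimplexCover B d (Fin d → ℝ) (by simp) g hbdd
  refine ⟨T.image Prod.fst, ?_, ?_, ?_, ?_⟩
  · refine Finset.card_image_le.trans (hTcard.trans (le_of_eq ?_))
    simp [mul_comm d 2]
  · intro τ hτ
    obtain ⟨t, ht, rfl⟩ := Finset.mem_image.1 hτ
    exact hT.card_le t ht
  · intro τ hτ v hv v' hv'
    obtain ⟨t, ht, rfl⟩ := Finset.mem_image.1 hτ
    have hmemV : ∀ v ∈ t.1, v ∈ V := by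
      intro v hv
      obtain ⟨J, hJ⟩ := hT.vertex t ht v hv
      exact hV v ⟨fun k => Sum.map ρ id (J k), by simpa only [hg] using hJ⟩
    by_contra! hD
    obtain ⟨k, hk⟩ := hρ (v, v') (Finset.mk_mem_product (hmemV v hv) (hmemV v' hv')) hD
    obtain ⟨h1, h2⟩ := (Finset.mem_filter.1 hk).2
    have c1 : 0 ≤ ((t.2 (Sum.inl k) : SignType) : ℝ) * f (ρ k) v := hT.mem_cell t ht v hv (Sum.inl k)
    have c2 : 0 ≤ ((t.2 (Sum.inl k) : SignType) : ℝ) * f (ρ k) v' := hT.mem_cell t ht v' hv' (Sum.inl k)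
    have c3 : t.2 (Sum.inl k) = 0 := by
      cases h : t.2 (Sum.inl k)
      · rfl
      · rw [h] at c2; simp at c2; linarith
      · rw [h] at c1; simp at c1; linarith
    have c4 : f (ρ k) v = 0 := (hT.sign_eq_zero t ht (Sum.inl k)).1 c3 v
    linarith
  · intro q hq
    obtain ⟨t, ht, hqt⟩ := hT.cover q (by
      intro i hi
      obtain ⟨⟨i, b⟩, -, rfl⟩ := Finset.mem_image.1 hi
      left
      simp only [g, Sum.elim_inr, boxFunctional_apply]
      have := abs_lt.1 (hR q hq i)
      cases b <;> simp <;> linarith)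
    exact ⟨t.1, Finset.mem_image_of_mem _ ht, hqt⟩

/-! ### Rich points -/

/-- By Cauchy–Schwarz, S = Σ |A c| satisfies S² ≤ |X| (S + |C|² s); the last hypothesis makes |X|
|C|² s at most S²/2. -/
theorem card_mul_le_of_card_inter_le {α β : Type} [DecidableEq α] (C : Finset β) (A : β → Finset α)
    (X : Finset α) {a s : ℕ} (hX : ∀ c ∈ C, A c ⊆ X) (ha : ∀ c ∈ C, a ≤ (A c).card)
    (hs : ∀ c ∈ C, ∀ c' ∈ C, c ≠ c' → (A c ∩ A c').card ≤ s) (h : 2 * s * X.card ≤ a ^ 2) :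
    C.card * a ≤ 2 * X.card := by
  classical
  set S := ∑ c ∈ C, (A c).card with hS
  have hCS : C.card * a ≤ S := by
    rw [← smul_eq_mul]; exact Finset.card_nsmul_le_sum _ _ _ ha
  let deg : α → ℕ := fun x => ∑ c ∈ C, if x ∈ A c then 1 else 0
  have hcard : ∀ Y ⊆ X, Y.card = ∑ x ∈ X, if x ∈ Y then 1 else 0 := by
    intro Y hY
    rw [← Finset.sum_filter, Finset.sum_const, smul_eq_mul, mul_one, Finset.filter_mem_eq_inter,
      Finset.inter_eq_right.2 hY]
  have h1 : ∑ x ∈ X, deg x = S := by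
    rw [Finset.sum_comm]
    exact Finset.sum_congr rfl fun c hc => (hcard _ (hX c hc)).symm
  have h2 : ∑ x ∈ X, deg x ^ 2 = ∑ c ∈ C, ∑ c' ∈ C, (A c ∩ A c').card := by
    have : ∀ c ∈ C, ∀ c' ∈ C, (A c ∩ A c').card =
        ∑ x ∈ X, (if x ∈ A c then 1 else 0) * (if x ∈ A c' then 1 else 0) := by
      intro c hc c' _
      rw [hcard _ (Finset.inter_subset_left.trans (hX c hc))]
      refine Finset.sum_congr rfl fun x _ => ?_
      by_cases h1 : x ∈ A c <;> by_cases h2 : x ∈ A c' <;> simp [h1, h2]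
    rw [Finset.sum_congr rfl fun c hc => Finset.sum_congr rfl (this c hc)]
    simp only [deg, sq, Finset.sum_mul_sum]
    rw [Finset.sum_comm]
    exact Finset.sum_congr rfl fun c _ => Finset.sum_comm
  have h3 : ∑ c ∈ C, ∑ c' ∈ C, (A c ∩ A c').card ≤ S + C.card ^ 2 * s := by
    calc _ ≤ ∑ c ∈ C, ((A c).card + C.card * s) := by
          refine Finset.sum_le_sum fun c hc => ?_
          rw [← Finset.add_sum_erase _ _ hc, Finset.inter_self]
          refine Nat.add_le_add_left ?_ _
          calc _ ≤ (C.erase c).card • s := Finset.sum_le_card_nsmul _ _ _ fun c' hc' =>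
                hs c hc c' (Finset.mem_of_mem_erase hc') (Finset.ne_of_mem_erase hc').symm
            _ ≤ C.card * s := Nat.mul_le_mul_right _ (Finset.card_erase_le)
      _ = _ := by rw [Finset.sum_add_distrib, Finset.sum_const, smul_eq_mul]; ring
  have h4 : S ^ 2 ≤ X.card * (S + C.card ^ 2 * s) := by
    calc S ^ 2 = (∑ x ∈ X, deg x) ^ 2 := by rw [h1]
      _ ≤ X.card * ∑ x ∈ X, deg x ^ 2 := sq_sum_le_card_mul_sum_sq
      _ ≤ _ := Nat.mul_le_mul_left _ (h2 ▸ h3)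
  have h5 : C.card ^ 2 * (2 * s * X.card) ≤ S ^ 2 :=
    calc _ ≤ C.card ^ 2 * a ^ 2 := Nat.mul_le_mul_left _ h
      _ = (C.card * a) ^ 2 := by ring
      _ ≤ S ^ 2 := Nat.pow_le_pow_left hCS 2
  refine hCS.trans ?_
  by_contra! hlt
  nlinarith

/-- With all weights positive, a hyperplane through q either strictly separates two of the chosen
vertices or contains them all. -/
theorem exists_pos_weights {E : Type} [AddCommGroup E] [Module ℝ E] {τ : Finset E} {q : E}
    (hq : q ∈ convexHull ℝ (τ : Set E)) : ∃ τ' ⊆ τ, ∃ a : E → ℝ,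
      (∀ v ∈ τ', 0 < a v) ∧ ∑ v ∈ τ', a v = 1 ∧ ∑ v ∈ τ', a v • v = q := by
  classical
  obtain ⟨a, ha0, ha1, haq⟩ := Finset.mem_convexHull'.1 hq
  refine ⟨τ.filter fun v => 0 < a v, Finset.filter_subset _ _, a,
    fun v hv => (Finset.mem_filter.1 hv).2, ?_, ?_⟩
  · rw [← ha1]
    refine Finset.sum_filter_of_ne fun v hv h => lt_of_le_of_ne (ha0 v hv) h.symm
  · rw [← haq]
    refine Finset.sum_filter_of_ne fun v hv h => lt_of_le_of_ne (ha0 v hv) fun h0 => h ?_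
    rw [← h0, zero_smul]

/-- The number of `k`-rich points of an arrangement of hyperplanes in `ℝᵈ`, any two of which share at
most `s` hyperplanes. -/
theorem card_rich_mul_le {α β : Type} [Fintype α] {d r D k s : ℕ} (f : α → (Fin d → ℝ) →ᵃ[ℝ] ℝ)
    (hr : (Fintype.card α + 2 * d) ^ (2 * d) * (Fintype.card α - D) ^ r < Fintype.card α ^ r)
    (Q : Finset β) (w : β → Fin d → ℝ)
    (hk : ∀ c ∈ Q, k ≤ (Finset.univ.filter fun p => f p (w c) = 0).card)
    (hs : ∀ c ∈ Q, ∀ c' ∈ Q, c ≠ c' →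
      (Finset.univ.filter fun p => f p (w c) = 0 ∧ f p (w c') = 0).card ≤ s)
    (hsk : 2 * s ≤ k) (hD : 8 * s * ((d + 1) ^ 2 * D) ≤ k ^ 2) :
    Q.card * k ≤ (2 * (r + 2 * d)) ^ d * 2 ^ (d + 1) * (k + 4 * ((d + 1) ^ 2 * D)) := by
  classical
  obtain ⟨T, hTcard, hTdim, hTsep, hTcov⟩ := exists_cutting f hr (Q.image w)
  -- Points are classed by the vertices carrying positive weight rather than by simplex; each
  -- simplex has at most 2^(d+1) vertex subsets.
  have hkey : ∀ c : β, ∃ τ' : Finset (Fin d → ℝ), c ∈ Q → ∃ τ ∈ T, τ' ⊆ τ ∧ ∃ a : (Fin d → ℝ) → ℝ,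
      (∀ v ∈ τ', 0 < a v) ∧ ∑ v ∈ τ', a v = 1 ∧ ∑ v ∈ τ', a v • v = w c := by
    intro c
    by_cases hc : c ∈ Q
    · obtain ⟨τ, hτ, hq⟩ := hTcov _ (Finset.mem_image_of_mem w hc)
      obtain ⟨τ', hsub, h⟩ := exists_pos_weights hq
      exact ⟨τ', fun _ => ⟨τ, hτ, hsub, h⟩⟩
    · exact ⟨∅, fun h => absurd h hc⟩
  choose key hkey using hkey
  have hfib : ∀ τ' ∈ Q.image key, (Q.filter fun c => key c = τ').card * k ≤
      k + 4 * ((d + 1) ^ 2 * D) := by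
    intro τ' hτ'
    set C := Q.filter fun c => key c = τ' with hC
    rcases Nat.lt_or_ge 1 C.card with h1 | h1
    swap
    · exact (Nat.mul_le_mul_right k h1).trans (by omega)
    obtain ⟨c0, hc0Q, hc0⟩ := Finset.mem_image.1 hτ'
    obtain ⟨τ, hτ, hsub, -⟩ := hkey c0 hc0Q
    rw [hc0] at hsub
    let X : Finset α := (τ' ×ˢ τ').biUnion fun v =>
      Finset.univ.filter fun p => f p v.1 < 0 ∧ 0 < f p v.2
    have hXcard : X.card ≤ (d + 1) ^ 2 * D := by
      refine (Finset.card_biUnion_le_card_mul _ _ D fun v hv => ?_).trans ?_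
      · obtain ⟨h1, h2⟩ := Finset.mem_product.1 hv
        exact hTsep τ hτ _ (hsub h1) _ (hsub h2)
      · have : τ'.card ≤ d + 1 := (Finset.card_le_card hsub).trans (hTdim τ hτ)
        rw [Finset.card_product, sq]
        exact Nat.mul_le_mul_right _ (Nat.mul_le_mul this this)
    -- a hyperplane through a point of the class either crosses the simplex or contains the class
    have hdich : ∀ c ∈ C, ∀ p, f p (w c) = 0 → p ∉ X → ∀ c' ∈ C, f p (w c') = 0 := by
      intro c hc p hp hpX c' hc'
      obtain ⟨hcQ, hcτ⟩ := Finset.mem_filter.1 hc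
      obtain ⟨hcQ', hcτ'⟩ := Finset.mem_filter.1 hc'
      obtain ⟨-, -, -, a, ha, ha1, haw⟩ := hkey c hcQ
      obtain ⟨-, -, -, a', ha', ha1', haw'⟩ := hkey c' hcQ'
      rw [hcτ] at ha ha1 haw
      rw [hcτ'] at ha' ha1' haw'
      have hnot : ∀ v ∈ τ', ∀ v' ∈ τ', ¬ (f p v < 0 ∧ 0 < f p v') := by
        intro v hv v' hv' h
        exact hpX (Finset.mem_biUnion.2 ⟨(v, v'), Finset.mk_mem_product hv hv',
          Finset.mem_filter.2 ⟨Finset.mem_univ _, h⟩⟩)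
      have hsum : ∑ v ∈ τ', a v * f p v = 0 := by
        rw [← AffineMap.apply_sum_smul (f p) ha1, haw, hp]
      have hz : ∀ v ∈ τ', f p v = 0 := by
        by_cases hneg : ∃ v ∈ τ', f p v < 0
        · obtain ⟨v, hv, hvneg⟩ := hneg
          have hle : ∀ v' ∈ τ', f p v' ≤ 0 := fun v' hv' =>
            not_lt.1 fun h => hnot v hv v' hv' ⟨hvneg, h⟩
          have h2 := (Finset.sum_eq_zero_iff_of_nonpos fun v' hv' =>
            mul_nonpos_of_nonneg_of_nonpos (ha v' hv').le (hle v' hv')).1 hsum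
          exact fun v' hv' => (mul_eq_zero.1 (h2 v' hv')).resolve_left (ha v' hv').ne'
        · push Not at hneg
          have h2 := (Finset.sum_eq_zero_iff_of_nonneg fun v' hv' =>
            mul_nonneg (ha v' hv').le (hneg v' hv')).1 hsum
          exact fun v' hv' => (mul_eq_zero.1 (h2 v' hv')).resolve_left (ha v' hv').ne'
      rw [← haw', AffineMap.apply_sum_smul (f p) ha1']
      exact Finset.sum_eq_zero fun v hv => by rw [hz v hv, mul_zero]
    let A : β → Finset α := fun c => X.filter fun p => f p (w c) = 0
    -- A hyperplane through c outside X also passes through any second point c' of the class, so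
    -- there are at most s of these.
    have hA : ∀ c ∈ C, k - s ≤ (A c).card := by
      intro c hc
      obtain ⟨c', hc', hne⟩ := Finset.exists_mem_ne h1 c
      have hcQ := (Finset.mem_filter.1 hc).1
      have hcQ' := (Finset.mem_filter.1 hc').1
      have hsubset : (Finset.univ.filter fun p => f p (w c) = 0) ⊆
          A c ∪ (Finset.univ.filter fun p => f p (w c) = 0 ∧ f p (w c') = 0) := by
        intro p hp
        have hp0 := (Finset.mem_filter.1 hp).2
        by_cases hpX : p ∈ X
        · exact Finset.mem_union_left _ (Finset.mem_filter.2 ⟨hpX, hp0⟩)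
        · exact Finset.mem_union_right _ (Finset.mem_filter.2 ⟨Finset.mem_univ _, hp0,
            hdich c hc p hp0 hpX c' hc'⟩)
      have h2 := (hk c hcQ).trans ((Finset.card_le_card hsubset).trans (Finset.card_union_le _ _))
      have h3 := hs c hcQ c' hcQ' hne.symm
      omega
    have hks : k ≤ 2 * (k - s) := by omega
    have hmain := card_mul_le_of_card_inter_le C A X (a := k - s) (s := s)
      (fun c _ => Finset.filter_subset _ _) hA
      (by
        intro c hc c' hc' hne
        refine (Finset.card_le_card ?_).trans
          (hs c (Finset.mem_filter.1 hc).1 c' (Finset.mem_filter.1 hc').1 hne)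
        intro p hp
        obtain ⟨h1, h2⟩ := Finset.mem_inter.1 hp
        exact Finset.mem_filter.2 ⟨Finset.mem_univ _, (Finset.mem_filter.1 h1).2,
          (Finset.mem_filter.1 h2).2⟩)
      (by
        have h2 : 8 * s * X.card ≤ (2 * (k - s)) ^ 2 :=
          (Nat.mul_le_mul_left _ hXcard).trans (hD.trans (Nat.pow_le_pow_left hks 2))
        nlinarith)
    calc C.card * k ≤ C.card * (2 * (k - s)) := Nat.mul_le_mul_left _ hks
      _ = 2 * (C.card * (k - s)) := by ring
      _ ≤ 2 * (2 * X.card) := Nat.mul_le_mul_left _ hmain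
      _ ≤ 2 * (2 * ((d + 1) ^ 2 * D)) := by gcongr
      _ ≤ _ := by omega
  have himg : (Q.image key).card ≤ (2 * (r + 2 * d)) ^ d * 2 ^ (d + 1) := by
    have hsub : Q.image key ⊆ T.biUnion Finset.powerset := by
      intro τ' hτ'
      obtain ⟨c, hc, rfl⟩ := Finset.mem_image.1 hτ'
      obtain ⟨τ, hτ, hsub, -⟩ := hkey c hc
      exact Finset.mem_biUnion.2 ⟨τ, hτ, Finset.mem_powerset.2 hsub⟩
    refine (Finset.card_le_card hsub).trans
      ((Finset.card_biUnion_le_card_mul _ _ (2 ^ (d + 1)) fun τ hτ => ?_).trans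
        (Nat.mul_le_mul_right _ hTcard))
    rw [Finset.card_powerset]
    exact Nat.pow_le_pow_right (by norm_num) (hTdim τ hτ)
  calc Q.card * k = ∑ τ' ∈ Q.image key, (Q.filter fun c => key c = τ').card * k := by
        rw [← Finset.sum_mul, ← Finset.card_eq_sum_card_image]
    _ ≤ (Q.image key).card • (k + 4 * ((d + 1) ^ 2 * D)) := Finset.sum_le_card_nsmul _ _ _ hfib
    _ ≤ _ := Nat.mul_le_mul_right _ himg

/-! ### Counting rich points in dimension four -/

/-- Since (1 − D/n)^r ≤ exp(−r D/n), any r above 8 (n/D) log(n + 8) beats the factor (n + 8)^8,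
which is (n + 2d)^{2d} for d = 4. -/
theorem exists_sample_size (n D : ℕ) (hn : 1 ≤ n) (hD : 1 ≤ D) :
    ∃ r : ℕ, (n + 8) ^ 8 * (n - D) ^ r < n ^ r ∧
      (r : ℝ) ≤ 8 * n * Real.log (n + 8) / D + 1 := by
  have hn' : (0 : ℝ) < n := by exact_mod_cast hn
  have hD' : (0 : ℝ) < D := by exact_mod_cast hD
  have hlog : 0 ≤ Real.log (n + 8) := Real.log_nonneg (by linarith)
  set y : ℝ := 8 * n * Real.log (n + 8) / D with hy
  refine ⟨⌊y⌋₊ + 1, ?_, ?_⟩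
  swap
  · push_cast
    gcongr
    exact Nat.floor_le (by positivity)
  set r := ⌊y⌋₊ + 1 with hr
  have hyr : y < r := by rw [hr]; push_cast; exact Nat.lt_floor_add_one y
  have h1 : ((n - D : ℕ) : ℝ) ≤ n * Real.exp (-(D / n)) := by
    rcases le_total n D with h | h
    · rw [Nat.sub_eq_zero_of_le h]; push_cast; positivity
    · rw [Nat.cast_sub h]
      have := Real.add_one_le_exp (-((D : ℝ) / n))
      calc (n : ℝ) - D = n * (-((D : ℝ) / n) + 1) := by field_simp; ring
        _ ≤ _ := by gcongr
  have h2 : ((n : ℝ) + 8) ^ 8 < Real.exp (r * (D / n)) := by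
    have h3 : Real.log (((n : ℝ) + 8) ^ 8) < r * (D / n) := by
      rw [Real.log_pow]
      have : y * (D / n) = 8 * Real.log (n + 8) := by rw [hy]; field_simp
      push_cast
      rw [← this]
      gcongr
    exact (Real.log_lt_iff_lt_exp (by positivity)).1 h3
  have h4 : ((n : ℝ) + 8) ^ 8 * ((n - D : ℕ) : ℝ) ^ r < (n : ℝ) ^ r := by
    calc ((n : ℝ) + 8) ^ 8 * ((n - D : ℕ) : ℝ) ^ r
        ≤ ((n : ℝ) + 8) ^ 8 * (n * Real.exp (-(D / n))) ^ r := by gcongr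
      _ = ((n : ℝ) + 8) ^ 8 * (n ^ r * (Real.exp (r * (D / n)))⁻¹) := by
          rw [mul_pow, ← Real.exp_nat_mul, mul_neg, Real.exp_neg]
      _ < Real.exp (r * (D / n)) * (n ^ r * (Real.exp (r * (D / n)))⁻¹) := by gcongr
      _ = n ^ r := by
          have := (Real.exp_pos (r * ((D : ℝ) / n))).ne'
          field_simp
  exact_mod_cast h4

theorem one_le_log_add_eight (n : ℕ) : 1 ≤ Real.log ((n : ℝ) + 8) := by
  rw [Real.le_log_iff_exp_le (by positivity)]
  have := Real.exp_one_lt_d9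
  have : (0 : ℝ) ≤ n := by positivity
  linarith

theorem sq_mul_card_rich_le {α β : Type} [Fintype α] {k s : ℕ} (f : α → (Fin 4 → ℝ) →ᵃ[ℝ] ℝ)
    (Q : Finset β) (w : β → Fin 4 → ℝ)
    (hk : ∀ c ∈ Q, k ≤ (Finset.univ.filter fun p => f p (w c) = 0).card)
    (hs : ∀ c ∈ Q, ∀ c' ∈ Q, c ≠ c' →
      (Finset.univ.filter fun p => f p (w c) = 0 ∧ f p (w c') = 0).card ≤ s)
    (hs1 : 1 ≤ s) (hsk : 200 * s ≤ k) (hkn : k ≤ Fintype.card α) {x : ℝ}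
    (hx1 : 1 ≤ x) (hx3 : x ^ 3 = Fintype.card α) (hxk : x ≤ k) :
    (k : ℝ) ^ 2 * Q.card ≤
      32 * 6400 ^ 4 * 1616 * (s * Real.log (Fintype.card α + 8)) ^ 4 * x ^ 7 := by
  set n := Fintype.card α with hn
  set l := Real.log ((n : ℝ) + 8) with hl
  have hl1 : 1 ≤ l := one_le_log_add_eight n
  have hk1 : 1 ≤ k := by omega
  have hn1 : 1 ≤ n := hk1.trans hkn
  -- Here 200 = 8 (d + 1)² for d = 4, the constant demanded by `card_rich_mul_le`.
  set D := min (k ^ 2 / (200 * s)) n with hDdef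
  have hD1 : 1 ≤ D := by
    refine le_min ((Nat.one_le_div_iff (by positivity)).2 ?_) hn1
    nlinarith
  have hDk : 200 * s * D ≤ k ^ 2 :=
    (Nat.mul_le_mul_left _ (min_le_left _ _)).trans (Nat.mul_div_le _ _)
  have hDn : D ≤ n := min_le_right _ _
  obtain ⟨r, hr, hrle⟩ := exists_sample_size n D hn1 hD1
  have hmain := card_rich_mul_le (D := D) (r := r) f (by simpa using hr) Q w hk hs (by omega)
    (by rw [← hn] at *; nlinarith)
  have hkpos : (0 : ℝ) < k := by exact_mod_cast hk1
  have hnpos : (0 : ℝ) < n := by exact_mod_cast hn1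
  have hspos : (1 : ℝ) ≤ s := by exact_mod_cast hs1
  have hDpos : (0 : ℝ) < D := by exact_mod_cast hD1
  have hr8 : (r : ℝ) + 8 ≤ 3200 * (s * l) * (1 + n / k ^ 2) := by
    have h1 : 8 * n * l / D ≤ 8 * l + 3200 * (s * l) * (n / k ^ 2) := by
      rcases le_total (k ^ 2 / (200 * s)) n with h | h
      · have hD2 : D = k ^ 2 / (200 * s) := min_eq_left h
        have h3 : k ^ 2 ≤ 400 * s * D := by
          have := Nat.lt_mul_div_succ (k ^ 2) (b := 200 * s) (by positivity)
          rw [← hD2] at this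
          nlinarith
        have h4 : (k : ℝ) ^ 2 ≤ 400 * s * D := by exact_mod_cast h3
        have h5 : 8 * n * l / D ≤ 3200 * (s * l) * (n / k ^ 2) := by
          rw [div_le_iff₀ hDpos]
          calc 8 * n * l = 8 * n * l * (k ^ 2 / k ^ 2) := by field_simp
            _ ≤ 8 * n * l * (400 * s * D / k ^ 2) := by gcongr
            _ = _ := by ring
        linarith
      · have hD2 : D = n := min_eq_right h
        have h5 : 8 * n * l / D = 8 * l := by rw [hD2]; field_simp
        rw [h5]
        have : 0 ≤ 3200 * (s * l) * (n / k ^ 2) := by positivity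
        linarith
    have h2 : l ≤ s * l := le_mul_of_one_le_left (by linarith) hspos
    have h6 : 3200 * (s * l) * (1 + n / k ^ 2) = 3200 * (s * l) + 3200 * (s * l) * (n / k ^ 2) := by ring
    rw [h6]
    linarith
  have hmain' : (Q.card : ℝ) * k ≤ (2 * ((r : ℝ) + 8)) ^ 4 * 32 * (k + 100 * D) := by
    have : Q.card * k ≤ (2 * (r + 8)) ^ 4 * 32 * (k + 100 * D) := by
      refine hmain.trans (le_of_eq ?_); ring
    exact_mod_cast this
  -- For k² ≤ n the left side is O(n⁴/k⁵) = O(x^{12}/k⁵), at most O(x⁷) because k ≥ x; for k² ≥ n it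
  -- is O(n²) = O(x⁶).
  have hfin : (1 + n / (k : ℝ) ^ 2) ^ 4 * ((k + 100 * D) * k) ≤ 1616 * x ^ 7 := by
    have hxpos : 0 < x := by linarith
    rcases le_total ((k : ℝ) ^ 2) n with h | h
    · have h1 : 1 + n / (k : ℝ) ^ 2 ≤ 2 * (n / (k : ℝ) ^ 2) := by
        have : 1 ≤ n / (k : ℝ) ^ 2 := (one_le_div (by positivity)).2 h
        linarith
      have h2 : ((k : ℝ) + 100 * D) * k ≤ 2 * k ^ 3 := by
        have h3 : (100 : ℝ) * D ≤ k ^ 2 := by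
          have : 100 * D ≤ k ^ 2 := by nlinarith
          exact_mod_cast this
        have h4 : (k : ℝ) ≤ k ^ 2 := by
          have : (1 : ℝ) ≤ k := by exact_mod_cast hk1
          nlinarith
        calc ((k : ℝ) + 100 * D) * k ≤ (k ^ 2 + k ^ 2) * k := by gcongr
          _ = _ := by ring
      calc (1 + n / (k : ℝ) ^ 2) ^ 4 * ((k + 100 * D) * k)
          ≤ (2 * (n / (k : ℝ) ^ 2)) ^ 4 * (2 * k ^ 3) := by gcongr
        _ = 32 * x ^ 7 * (x ^ 5 / k ^ 5) := by rw [← hx3]; field_simp; ring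
        _ ≤ 32 * x ^ 7 * 1 := by
            gcongr
            exact (div_le_one (by positivity)).2 (pow_le_pow_left₀ hxpos.le hxk 5)
        _ ≤ 1616 * x ^ 7 := by have : 0 < x ^ 7 := by positivity
                               linarith
    · have h1 : 1 + n / (k : ℝ) ^ 2 ≤ 2 := by
        have : n / (k : ℝ) ^ 2 ≤ 1 := (div_le_one (by positivity)).2 h
        linarith
      have h2 : ((k : ℝ) + 100 * D) * k ≤ 101 * (n * n) := by
        have h3 : (k : ℝ) ≤ n := by exact_mod_cast hkn
        have h4 : (D : ℝ) ≤ n := by exact_mod_cast hDn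
        calc ((k : ℝ) + 100 * D) * k ≤ (n + 100 * n) * n := by gcongr
          _ = _ := by ring
      calc (1 + n / (k : ℝ) ^ 2) ^ 4 * ((k + 100 * D) * k) ≤ 2 ^ 4 * (101 * (n * n)) := by gcongr
        _ = 1616 * x ^ 6 := by rw [← hx3]; ring
        _ ≤ 1616 * x ^ 7 := by
            gcongr
            norm_num
  calc (k : ℝ) ^ 2 * Q.card = (Q.card * k) * k := by ring
    _ ≤ ((2 * ((r : ℝ) + 8)) ^ 4 * 32 * (k + 100 * D)) * k := by gcongr
    _ ≤ ((2 * (3200 * (s * l) * (1 + n / k ^ 2))) ^ 4 * 32 * (k + 100 * D)) * k := by gcongr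
    _ = 32 * 6400 ^ 4 * (s * l) ^ 4 * ((1 + n / (k : ℝ) ^ 2) ^ 4 * ((k + 100 * D) * k)) := by ring
    _ ≤ 32 * 6400 ^ 4 * (s * l) ^ 4 * (1616 * x ^ 7) := by gcongr
    _ = _ := by ring

/-! ### Duality between lattice points and hyperplanes -/

/-- The functional `y ↦ 2 p ⬝ y - 1` attached to a lattice point `p`. -/
noncomputable def dualFunctional (p : Fin 4 → ℤ) : (Fin 4 → ℝ) →ᵃ[ℝ] ℝ :=
  (∑ i, (2 * (p i : ℝ)) • (LinearMap.proj i : (Fin 4 → ℝ) →ₗ[ℝ] ℝ)).toAffineMap -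
    AffineMap.const ℝ _ 1

/-- The dual point `c / |c|²` of the hyperplane `2 x ⬝ c = |c|²`. -/
noncomputable def dualPoint (c : Fin 4 → ℤ) : Fin 4 → ℝ := fun i => (c i : ℝ) / ((c ⬝ᵥ c : ℤ) : ℝ)

theorem dualFunctional_dualPoint_eq_zero_iff {p c : Fin 4 → ℤ} (hc : c ≠ 0) :
    dualFunctional p (dualPoint c) = 0 ↔ 2 * (p ⬝ᵥ c) = c ⬝ᵥ c := by
  have hpos : (0 : ℝ) < ((c ⬝ᵥ c : ℤ) : ℝ) := by exact_mod_cast dotProduct_self_pos_int hc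
  have h1 : dualFunctional p (dualPoint c) = 2 * ((p ⬝ᵥ c : ℤ) : ℝ) / ((c ⬝ᵥ c : ℤ) : ℝ) - 1 := by
    have : 2 * ((p ⬝ᵥ c : ℤ) : ℝ) / ((c ⬝ᵥ c : ℤ) : ℝ) =
        ∑ i, 2 * (p i : ℝ) * ((c i : ℝ) / ((c ⬝ᵥ c : ℤ) : ℝ)) := by
      rw [show ((p ⬝ᵥ c : ℤ) : ℝ) = ∑ i, (p i : ℝ) * (c i : ℝ) by simp [dotProduct], Finset.mul_sum,
        Finset.sum_div]
      exact Finset.sum_congr rfl fun i _ => by ring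
    rw [this]
    simp [dualFunctional, dualPoint]
  rw [h1, sub_eq_zero, div_eq_one_iff_eq hpos.ne']
  exact_mod_cast Iff.rfl

/-- If c' = t c, then t |c|² = 2 p·c' = t² |c|² forces t = 1. So two distinct H_c that meet do so in
a genuine plane. -/
theorem eq_of_parallel_hyperplanes {p c c' : Fin 4 → ℤ} (hc : c ≠ 0) (hc' : c' ≠ 0)
    (hp : 2 * (p ⬝ᵥ c) = c ⬝ᵥ c) (hp' : 2 * (p ⬝ᵥ c') = c' ⬝ᵥ c')
    (h : (c ⬝ᵥ c) • c' - (c ⬝ᵥ c') • c = 0) : c = c' := by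
  have k1 := congrArg (fun z => p ⬝ᵥ z) h
  have k2 := congrArg (fun z => c' ⬝ᵥ z) h
  simp only [dotProduct_sub, dotProduct_smul, smul_eq_mul, dotProduct_zero] at k1 k2
  rw [dotProduct_comm c' c] at k2
  have e1 : c ⬝ᵥ c * (c' ⬝ᵥ c') = c ⬝ᵥ c * (c ⬝ᵥ c') := by
    linear_combination 2 * k1 - (c ⬝ᵥ c) * hp' + (c ⬝ᵥ c') * hp
  have e2 := mul_left_cancel₀ (dotProduct_self_pos_int hc).ne' e1
  have e3 : c' ⬝ᵥ c' * (c ⬝ᵥ c) = c' ⬝ᵥ c' * (c' ⬝ᵥ c') := by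
    rw [← e2] at k2; linarith
  have e4 := mul_left_cancel₀ (dotProduct_self_pos_int hc').ne' e3
  refine sub_eq_zero.1 (dotProduct_self_eq_zero.1 ?_)
  simp only [dotProduct_sub, sub_dotProduct]
  rw [dotProduct_comm c' c, ← e2, e4]; ring

theorem two_mul_dotProduct_eq_of_add_eq {lam : ℤ} {a b c : Fin 4 → ℤ} (ha : a ⬝ᵥ a = lam)
    (hb : b ⬝ᵥ b = lam) (h : a + b = c) : 2 * (a ⬝ᵥ c) = c ⬝ᵥ c := by
  rw [← h]
  simp only [dotProduct_add, add_dotProduct]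
  rw [dotProduct_comm b a]; linarith

/-! ### The energy bound -/

-- The value c = 0 has no dual point and is bounded by n². Values r(c) < 2K contribute at most 2K Σ
-- r(c) = 400 s x · n². The rest fall into at most 3 log(n + 8) dyadic levels, each losing a factor
-- 4. Hence 401 = 1 + 400 and 12 = 3 · 4.
open scoped Pointwise in
theorem addEnergy_le_of_card_inter_le {lam : ℤ} {Λ : Finset (Fin 4 → ℤ)} {s : ℕ} (hs1 : 1 ≤ s)
    (hΛ : ∀ p ∈ Λ, p ⬝ᵥ p = lam) (hne : Λ.Nonempty)
    (hs : ∀ c c' : Fin 4 → ℤ, c ≠ 0 → c' ≠ 0 → c ≠ c' →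
      (Λ.filter fun p => 2 * (p ⬝ᵥ c) = c ⬝ᵥ c ∧ 2 * (p ⬝ᵥ c') = c' ⬝ᵥ c').card ≤ s) :
    (Finset.addEnergy Λ Λ : ℝ) ≤ (401 + 12 * (32 * 6400 ^ 4 * 1616)) *
      ((s : ℝ) ^ 4 * Real.log (Λ.card + 8) ^ 5) * (Λ.card : ℝ) ^ (7 / 3 : ℝ) := by
  classical
  set n := Λ.card with hn
  have hn1 : 1 ≤ n := hne.card_pos
  set l := Real.log ((n : ℝ) + 8) with hl
  have hl1 : 1 ≤ l := one_le_log_add_eight n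
  have hs1' : (1 : ℝ) ≤ s := by exact_mod_cast hs1
  have hn1' : (1 : ℝ) ≤ n := by exact_mod_cast hn1
  set x : ℝ := (n : ℝ) ^ (1 / 3 : ℝ) with hx
  have hx1 : 1 ≤ x := Real.one_le_rpow hn1' (by norm_num)
  have hx3 : x ^ 3 = n := by
    rw [hx, ← Real.rpow_natCast, ← Real.rpow_mul (by positivity)]; norm_num
  have hx7 : (n : ℝ) ^ (7 / 3 : ℝ) = x ^ 7 := by
    rw [hx, ← Real.rpow_natCast, ← Real.rpow_mul (by positivity)]; norm_num
  rw [hx7]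
  set A : ℝ := 32 * 6400 ^ 4 * 1616 with hA
  let r : (Fin 4 → ℤ) → ℕ := fun c => ((Λ ×ˢ Λ).filter fun ab => ab.1 + ab.2 = c).card
  have hE : (Finset.addEnergy Λ Λ : ℝ) = ∑ c ∈ Λ + Λ, (r c : ℝ) ^ 2 := by
    rw [Finset.addEnergy_eq_sum_sq']; push_cast; rfl
  have hsum : ∑ c ∈ Λ + Λ, (r c : ℝ) = (n : ℝ) ^ 2 := by
    have : (Λ ×ˢ Λ).card = ∑ c ∈ Λ + Λ, r c :=
      Finset.card_eq_sum_card_fiberwise fun ab hab => by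
        obtain ⟨h1, h2⟩ := Finset.mem_product.1 hab
        exact Finset.add_mem_add h1 h2
    rw [Finset.card_product] at this
    rw [sq]; exact_mod_cast this.symm
  have hrle : ∀ c, r c ≤ (Λ.filter fun p => 2 * (p ⬝ᵥ c) = c ⬝ᵥ c).card := by
    intro c
    refine Finset.card_le_card_of_injOn Prod.fst ?_ ?_
    · intro ab hab
      obtain ⟨h1, h2⟩ := Finset.mem_filter.1 (Finset.mem_coe.1 hab)
      obtain ⟨h3, h4⟩ := Finset.mem_product.1 h1
      exact Finset.mem_coe.2 (Finset.mem_filter.2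
        ⟨h3, two_mul_dotProduct_eq_of_add_eq (hΛ _ h3) (hΛ _ h4) h2⟩)
    · intro ab hab ab' hab' h
      have h1 := (Finset.mem_filter.1 (Finset.mem_coe.1 hab)).2
      have h2 := (Finset.mem_filter.1 (Finset.mem_coe.1 hab')).2
      refine Prod.ext h (add_left_cancel (a := ab.1) ?_)
      rw [h1, h, h2]
  have hrn : ∀ c, r c ≤ n := fun c => (hrle c).trans (Finset.card_filter_le _ _)
  -- Large enough that 2^j ≥ K gives both 200 s ≤ 2^j and x ≤ 2^j.
  set K : ℝ := 200 * s * x with hK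
  let Q : ℕ → Finset (Fin 4 → ℤ) := fun j => (Λ + Λ).filter fun c => c ≠ 0 ∧ 2 ^ j ≤ r c
  have hQ : ∀ j ∈ Finset.range (Nat.log 2 n + 1), K ≤ 2 ^ j →
      ((2 : ℝ) ^ j) ^ 2 * (Q j).card ≤ A * (s * l) ^ 4 * x ^ 7 := by
    intro j hj hKj
    have hcard : Fintype.card Λ = n := by simp [hn]
    have huniv : ∀ P : (Fin 4 → ℤ) → Prop, ∀ [DecidablePred P],
        ((Finset.univ : Finset Λ).filter fun p => P p.1).card = (Λ.filter P).card := by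
      intro P _
      rw [← Finset.card_map (Function.Embedding.subtype _)]
      congr 1
      ext p
      simp [and_comm]
    have h1 : 200 * s ≤ 2 ^ j := by
      have : (200 : ℝ) * s ≤ 2 ^ j := le_trans (le_mul_of_one_le_right (by positivity) hx1) hKj
      exact_mod_cast this
    have h2 : x ≤ ((2 ^ j : ℕ) : ℝ) := by
      push_cast
      refine le_trans ?_ hKj
      rw [hK]
      exact le_mul_of_one_le_left (by linarith) (by linarith)
    have h3 : 2 ^ j ≤ Fintype.card Λ := by
      rw [hcard]
      exact Nat.pow_le_of_le_log (by omega) (by simpa [Nat.lt_succ_iff] using hj)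
    have := sq_mul_card_rich_le (α := Λ) (k := 2 ^ j) (s := s) (fun p => dualFunctional p.1) (Q j) dualPoint
      (by
        intro c hc
        obtain ⟨-, hc0, hcr⟩ := Finset.mem_filter.1 hc
        simp only [dualFunctional_dualPoint_eq_zero_iff hc0]
        rw [huniv fun p => 2 * (p ⬝ᵥ c) = c ⬝ᵥ c]
        exact hcr.trans (hrle c))
      (by
        intro c hc c' hc' hne
        obtain ⟨-, hc0, -⟩ := Finset.mem_filter.1 hc
        obtain ⟨-, hc0', -⟩ := Finset.mem_filter.1 hc'
        simp only [dualFunctional_dualPoint_eq_zero_iff hc0, dualFunctional_dualPoint_eq_zero_iff hc0']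
        rw [huniv fun p => 2 * (p ⬝ᵥ c) = c ⬝ᵥ c ∧ 2 * (p ⬝ᵥ c') = c' ⬝ᵥ c']
        exact hs c c' hc0 hc0' hne)
      hs1 h1 h3 hx1 (by rw [hx3, hcard]) h2
    rw [hcard] at this
    push_cast at this
    exact this
  have hpoint : ∀ c ∈ Λ + Λ, (r c : ℝ) ^ 2 ≤ (if c = 0 then (n : ℝ) ^ 2 else 0) + 2 * K * r c +
      ∑ j ∈ Finset.range (Nat.log 2 n + 1),
        if K ≤ 2 ^ j ∧ c ∈ Q j then 4 * ((2 : ℝ) ^ j) ^ 2 else 0 := by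
    intro c hc
    have hK0 : 0 ≤ K := by positivity
    have hsum0 : 0 ≤ ∑ j ∈ Finset.range (Nat.log 2 n + 1),
        if K ≤ 2 ^ j ∧ c ∈ Q j then 4 * ((2 : ℝ) ^ j) ^ 2 else 0 :=
      Finset.sum_nonneg fun j _ => by split_ifs <;> positivity
    have hr0 : 0 ≤ 2 * K * r c := by positivity
    by_cases hc0 : c = 0
    · have : (r c : ℝ) ≤ n := by exact_mod_cast hrn c
      have : (r c : ℝ) ^ 2 ≤ (n : ℝ) ^ 2 := by gcongr
      rw [if_pos hc0]; linarith
    rw [if_neg hc0, zero_add]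
    rcases Nat.eq_zero_or_pos (r c) with hz | hpos
    · rw [hz] at hr0 ⊢
      push_cast at hr0 ⊢
      linarith
    have hlo : 2 ^ Nat.log 2 (r c) ≤ r c := Nat.pow_log_le_self 2 hpos.ne'
    have hhi : r c < 2 ^ (Nat.log 2 (r c) + 1) := Nat.lt_pow_succ_log_self (by norm_num) _
    have hhi' : (r c : ℝ) ≤ 2 * 2 ^ Nat.log 2 (r c) := by
      have : r c ≤ 2 * 2 ^ Nat.log 2 (r c) := by rw [pow_succ] at hhi; omega
      exact_mod_cast this
    by_cases hKr : K ≤ 2 ^ Nat.log 2 (r c)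
    · have hmem : Nat.log 2 (r c) ∈ Finset.range (Nat.log 2 n + 1) :=
        Finset.mem_range.2 (Nat.lt_succ_of_le (Nat.log_mono_right (hrn c)))
      have hle := Finset.single_le_sum (f := fun j : ℕ =>
        if K ≤ 2 ^ j ∧ c ∈ Q j then 4 * ((2 : ℝ) ^ j) ^ 2 else 0)
        (fun j _ => by split_ifs <;> positivity) hmem
      rw [if_pos ⟨hKr, Finset.mem_filter.2 ⟨hc, hc0, hlo⟩⟩] at hle
      have : (r c : ℝ) ^ 2 ≤ (2 * 2 ^ Nat.log 2 (r c)) ^ 2 := by gcongr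
      rw [mul_pow] at this
      norm_num at this
      linarith
    · have : (r c : ℝ) * r c ≤ (2 * K) * r c := by
        refine mul_le_mul_of_nonneg_right ?_ (by positivity)
        push Not at hKr
        linarith
      rw [sq]; linarith
  have hlogn : ((Nat.log 2 n + 1 : ℕ) : ℝ) ≤ 3 * l := by
    have h1 : (2 : ℝ) ^ Nat.log 2 n ≤ n := by exact_mod_cast Nat.pow_log_le_self 2 (by omega)
    have h2 := Real.log_le_log (by positivity) h1
    rw [Real.log_pow] at h2
    have h3 := Real.log_two_gt_d9
    have h4 : Real.log n ≤ l := Real.log_le_log (by linarith) (by linarith)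
    have h5 : (0 : ℝ) ≤ Nat.log 2 n := by positivity
    push_cast
    nlinarith
  have hdy : ∑ c ∈ Λ + Λ, ∑ j ∈ Finset.range (Nat.log 2 n + 1),
      (if K ≤ 2 ^ j ∧ c ∈ Q j then 4 * ((2 : ℝ) ^ j) ^ 2 else 0) ≤
      3 * l * (4 * (A * (s * l) ^ 4 * x ^ 7)) := by
    rw [Finset.sum_comm]
    calc _ ≤ ∑ j ∈ Finset.range (Nat.log 2 n + 1), 4 * (A * (s * l) ^ 4 * x ^ 7) := by
          refine Finset.sum_le_sum fun j hj => ?_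
          by_cases hKj : K ≤ 2 ^ j
          · have h1 := hQ j hj hKj
            simp only [hKj, true_and]
            rw [← Finset.sum_filter, Finset.sum_const, nsmul_eq_mul]
            have h2 : ((Λ + Λ).filter fun c => c ∈ Q j) = Q j := by
              ext c; simp only [Q, Finset.mem_filter]; tauto
            rw [h2]; linarith
          · simp only [hKj, false_and, if_false, Finset.sum_const_zero]
            positivity
      _ = ((Nat.log 2 n + 1 : ℕ) : ℝ) * (4 * (A * (s * l) ^ 4 * x ^ 7)) := by
          rw [Finset.sum_const, Finset.card_range, nsmul_eq_mul]
      _ ≤ _ := by gcongr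
  have hzero : ∑ c ∈ Λ + Λ, (if c = 0 then (n : ℝ) ^ 2 else 0) ≤ (n : ℝ) ^ 2 := by
    rw [Finset.sum_ite_eq']
    split_ifs
    · exact le_rfl
    · positivity
  have hsl : s * 1 ≤ (s : ℝ) ^ 4 * l ^ 5 := by
    have h1 : (s : ℝ) ≤ s ^ 4 := le_self_pow₀ hs1' (by norm_num)
    have h2 : 1 ≤ l ^ 5 := one_le_pow₀ hl1
    gcongr
  calc (Finset.addEnergy Λ Λ : ℝ) = ∑ c ∈ Λ + Λ, (r c : ℝ) ^ 2 := hE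
    _ ≤ _ := Finset.sum_le_sum hpoint
    _ = (∑ c ∈ Λ + Λ, if c = 0 then (n : ℝ) ^ 2 else 0) + 2 * K * ∑ c ∈ Λ + Λ, (r c : ℝ) +
        ∑ c ∈ Λ + Λ, ∑ j ∈ Finset.range (Nat.log 2 n + 1),
          (if K ≤ 2 ^ j ∧ c ∈ Q j then 4 * ((2 : ℝ) ^ j) ^ 2 else 0) := by
        rw [Finset.sum_add_distrib, Finset.sum_add_distrib, Finset.mul_sum]
    _ ≤ (n : ℝ) ^ 2 + 2 * K * (n : ℝ) ^ 2 + 3 * l * (4 * (A * (s * l) ^ 4 * x ^ 7)) := by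
        rw [hsum]; gcongr
    _ = x ^ 6 + 400 * s * x ^ 7 + 12 * A * ((s : ℝ) ^ 4 * l ^ 5) * x ^ 7 := by
        rw [← hx3, hK]; ring
    _ ≤ s * 1 * x ^ 7 + 400 * (s * 1) * x ^ 7 + 12 * A * ((s : ℝ) ^ 4 * l ^ 5) * x ^ 7 := by
        have h1 : x ^ 6 ≤ x ^ 7 := pow_le_pow_right₀ hx1 (by norm_num)
        have h2 : x ^ 7 ≤ s * x ^ 7 := le_mul_of_one_le_left (by positivity) hs1'
        linarith
    _ ≤ (s : ℝ) ^ 4 * l ^ 5 * x ^ 7 + 400 * ((s : ℝ) ^ 4 * l ^ 5) * x ^ 7 +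
        12 * A * ((s : ℝ) ^ 4 * l ^ 5) * x ^ 7 := by gcongr
    _ = _ := by ring

/-- Every coordinate lies in [−N, N], so n ≤ (2N + 1)⁴ ≤ 81 N⁴, and 89 = 81 + 8. -/
theorem card_add_eight_le_of_subset_latticeSphere {lam : ℕ} {Λ : Finset (Fin 4 → ℤ)}
    (hΛ : (Λ : Set (Fin 4 → ℤ)) ⊆ latticeSphere 4 lam) :
    Λ.card + 8 ≤ 89 * sphereScale lam ^ 4 := by
  set N := sphereScale lam with hN
  have hN1 : 1 ≤ N := by rw [hN, sphereScale]; omega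
  have hlamN : lam ≤ N ^ 2 := by
    rw [hN, sphereScale, sq]; exact (Nat.lt_succ_sqrt lam).le
  have hsub : Λ ⊆ Fintype.piFinset fun _ : Fin 4 => Finset.Icc (-(N : ℤ)) N := by
    intro p hp
    refine Fintype.mem_piFinset.2 fun i => ?_
    have h1 : ∑ i, |p i| ^ 2 = (lam : ℤ) := hΛ hp
    have h2 : |p i| ^ 2 ≤ ∑ i, |p i| ^ 2 :=
      Finset.single_le_sum (f := fun i => |p i| ^ 2) (fun i _ => by positivity) (Finset.mem_univ i)
    have h3 : |p i| ^ 2 ≤ (N : ℤ) ^ 2 := by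
      rw [h1] at h2; exact h2.trans (by exact_mod_cast hlamN)
    exact Finset.mem_Icc.2 (abs_le.1 (le_of_sq_le_sq h3 (by positivity)))
  have h1 : Λ.card ≤ (2 * N + 1) ^ 4 := by
    refine (Finset.card_le_card hsub).trans (le_of_eq ?_)
    rw [Fintype.card_piFinset]
    simp only [Int.card_Icc, Finset.prod_const, Finset.card_univ, Fintype.card_fin]
    congr 1; omega
  have h2 : (2 * N + 1) ^ 4 ≤ (3 * N) ^ 4 := Nat.pow_le_pow_left (by omega) 4
  have h3 : 1 ≤ N ^ 4 := Nat.one_le_pow _ _ hN1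
  rw [mul_pow] at h2
  omega

theorem mainTheorem2 (ε : ℝ) (hε : 0 < ε) :
    ∃ C : ℝ, 0 < C ∧ ∀ lam : ℕ, 1 ≤ lam → ∀ Λ : Finset (Fin 4 → ℤ),
      (Λ : Set (Fin 4 → ℤ)) ⊆ latticeSphere 4 lam →
        (Finset.addEnergy Λ Λ : ℝ) ≤
          C * (sphereScale lam : ℝ) ^ ε * (Λ.card : ℝ) ^ (7 / 3 : ℝ) := by
  -- As λ ≤ N², s = O(N^{ε/8}) and s⁴ costs N^{ε/2}; the fifth power of log(n + 8) = O(N^{ε/10})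
  -- costs the other N^{ε/2}.
  obtain ⟨C, hC1, hC⟩ := exists_card_sphere_inter_plane_le (ε / 16) (by positivity)
  set A : ℝ := 401 + 12 * (32 * 6400 ^ 4 * 1616) with hA
  set L : ℝ := (89 : ℝ) ^ (ε / 40) / (ε / 40) with hL
  have hLpos : 0 < L := by positivity
  refine ⟨A * ((2 * C) ^ 4 * L ^ 5), by positivity, fun lam hlam Λ hΛ => ?_⟩
  set N : ℝ := (sphereScale lam : ℝ) with hN
  have hN1 : 1 ≤ N := by rw [hN, sphereScale]; push_cast; linarith [Nat.cast_nonneg (α := ℝ) (Nat.sqrt lam)]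
  rcases Λ.eq_empty_or_nonempty with rfl | hne
  · simp only [Finset.addEnergy_empty_left, Nat.cast_zero]
    positivity
  have hlamN : (lam : ℝ) ≤ N ^ 2 := by
    have : lam ≤ sphereScale lam ^ 2 := by rw [sphereScale, sq]; exact (Nat.lt_succ_sqrt lam).le
    rw [hN]; exact_mod_cast this
  have hsq : ∀ p ∈ Λ, p ⬝ᵥ p = (lam : ℤ) := by
    intro p hp
    have h1 : ∑ i, |p i| ^ 2 = (lam : ℤ) := hΛ hp
    rw [← h1]
    exact Finset.sum_congr rfl fun i _ => by rw [sq_abs, sq]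
  set s : ℕ := ⌈C * (lam : ℝ) ^ (ε / 16)⌉₊ with hs
  have hlam1 : (1 : ℝ) ≤ lam := by exact_mod_cast hlam
  have hbase : 1 ≤ C * (lam : ℝ) ^ (ε / 16) :=
    one_le_mul_of_one_le_of_one_le hC1 (Real.one_le_rpow hlam1 (by positivity))
  have hs1 : 1 ≤ s := Nat.one_le_ceil_iff.2 (by linarith)
  have hsle : (s : ℝ) ≤ 2 * C * N ^ (ε / 8) := by
    have h1 : (s : ℝ) < C * (lam : ℝ) ^ (ε / 16) + 1 := Nat.ceil_lt_add_one (by linarith)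
    have h2 : (lam : ℝ) ^ (ε / 16) ≤ N ^ (ε / 8) := by
      calc (lam : ℝ) ^ (ε / 16) ≤ (N ^ 2) ^ (ε / 16) :=
            Real.rpow_le_rpow (by positivity) hlamN (by positivity)
        _ = N ^ (ε / 8) := by
            rw [← Real.rpow_natCast, ← Real.rpow_mul (by positivity)]; congr 1; push_cast; ring
    have h3 := mul_le_mul_of_nonneg_left h2 (by linarith : (0 : ℝ) ≤ C)
    linarith
  have hmain := addEnergy_le_of_card_inter_le hs1 hsq hne (by
    intro c c' hc hc' hcc
    rcases (Λ.filter fun p => 2 * (p ⬝ᵥ c) = c ⬝ᵥ c ∧ 2 * (p ⬝ᵥ c') = c' ⬝ᵥ c').eq_empty_or_nonempty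
      with h | ⟨p, hp⟩
    · rw [h]; simp
    obtain ⟨-, hp1, hp2⟩ := Finset.mem_filter.1 hp
    have hpar : (c ⬝ᵥ c) • c' - (c ⬝ᵥ c') • c ≠ 0 := fun h =>
      hcc (eq_of_parallel_hyperplanes hc hc' hp1 hp2 h)
    -- The integer halves are exact: any x in the filtered set has 2 x·c = c·c and 2 x·c' = c'·c'.
    have := hC lam hlam c c' hc hpar (c ⬝ᵥ c / 2) (c' ⬝ᵥ c' / 2)
      (Λ.filter fun p => 2 * (p ⬝ᵥ c) = c ⬝ᵥ c ∧ 2 * (p ⬝ᵥ c') = c' ⬝ᵥ c') (fun x hx => by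
      obtain ⟨hxΛ, hx1, hx2⟩ := Finset.mem_filter.1 hx
      exact ⟨hsq x hxΛ, by omega, by omega⟩)
    exact_mod_cast this.trans (Nat.le_ceil _))
  have hl : Real.log (Λ.card + 8) ≤ L * N ^ (ε / 10) := by
    have h0 : ((Λ.card : ℝ) + 8) ≤ 89 * N ^ 4 := by
      rw [hN]; exact_mod_cast card_add_eight_le_of_subset_latticeSphere hΛ
    calc Real.log (Λ.card + 8) ≤ ((Λ.card : ℝ) + 8) ^ (ε / 40) / (ε / 40) :=
          Real.log_le_rpow_div (by positivity) (by positivity)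
      _ ≤ (89 * N ^ 4) ^ (ε / 40) / (ε / 40) := by gcongr
      _ = L * N ^ (ε / 10) := by
          rw [Real.mul_rpow (by norm_num) (by positivity), ← Real.rpow_natCast N 4,
            ← Real.rpow_mul (by positivity), hL]
          have : ((4 : ℕ) : ℝ) * (ε / 40) = ε / 10 := by push_cast; ring
          rw [this]; ring
  have hl0 : 0 ≤ Real.log ((Λ.card : ℝ) + 8) := by linarith [one_le_log_add_eight Λ.card]
  calc (Finset.addEnergy Λ Λ : ℝ)
      ≤ A * ((s : ℝ) ^ 4 * Real.log (Λ.card + 8) ^ 5) * (Λ.card : ℝ) ^ (7 / 3 : ℝ) := hmain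
    _ ≤ A * ((2 * C * N ^ (ε / 8)) ^ 4 * (L * N ^ (ε / 10)) ^ 5) * (Λ.card : ℝ) ^ (7 / 3 : ℝ) := by
        gcongr
    _ = A * ((2 * C) ^ 4 * L ^ 5) * ((N ^ (ε / 8)) ^ 4 * (N ^ (ε / 10)) ^ 5) *
          (Λ.card : ℝ) ^ (7 / 3 : ℝ) := by ring
    _ = A * ((2 * C) ^ 4 * L ^ 5) * N ^ ε * (Λ.card : ℝ) ^ (7 / 3 : ℝ) := by
        congr 2
        rw [← Real.rpow_natCast, ← Real.rpow_natCast, ← Real.rpow_mul (by positivity),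
          ← Real.rpow_mul (by positivity), ← Real.rpow_add (by linarith)]
        congr 1; push_cast; ring
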